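/- Let $K$ be a non-archimedean local field with valuation ring $R$, maximal ideal $\mathfrak p$ and residue field $\mathbb F_{\mathfrak p}=R/\mathfrak p$. Let $B$ be a finite-dimensional central simple $K$-algebra, $\mathcal O\subseteq B$ a maximal $R$-order, and $J$ the Jacobson radical of $\mathcal O$. The reduced norm $\operatorname{nrd}(I)$ of a left ideal $I\subseteq\mathcal O$ is the $R$-submodule of $K$ generated by the reduced norms of the elements of $I$, and $\mathrm{Id}(\mathcal O;\mathfrak p)$ is the set of left ideals $P\subseteq\mathcal O$ with $\operatorname{nrd}(P)=\mathfrak p$. For a field $F$ and $m\ge 1$ let $M_m^{(m-1)}(F)$ be the set of matrices of rank $m-1$ in $M_m(F)$ modulo left multiplication by $\mathrm{GL}_m(F)$, and for $Q\in\mathrm{GL}_m(F)$ let $\sigma_Q$ be the permutation of $M_m^{(m-1)}(F)$ induced by $A\mapsto AQ$. Then: (1) There are an integer $m\ge 1$ and a division $K$-algebra $D$ with $B\simeq M_m(D)$, a finite field extension $\mathbb F_q$ of $\mathbb F_{\mathfrak p}$, and a surjective ring homomorphism $\rho:\mathcal O\to M_m(\mathbb F_q)$ with kernel $J$ that is compatible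 with $R\to\mathbb F_{\mathfrak p}\to\mathbb F_q$; that is, $\rho$ is reduction modulo $J$ followed by an isomorphism $\mathcal O/J\simeq M_m(\mathbb F_q)$. (2) For every $\omega\in\mathcal O^\times$ the map $\sigma_\omega: P\mapsto P\omega+\mathcal O\mathfrak p$ is a permutation of $\mathrm{Id}(\mathcal O;\mathfrak p)$. (3) For every $m$, every field $\mathbb F_q$ and every surjective ring homomorphism $\rho:\mathcal O\to M_m(\mathbb F_q)$ with kernel $J$, sending $P\in\mathrm{Id}(\mathcal O;\mathfrak p)$ to the set $\{A : M_m(\mathbb F_q)A=\rho(P)\}$ of generators of $\rho(P)$ defines a bijection $\Phi:\mathrm{Id}(\mathcal O;\mathfrak p)\to M_m^{(m-1)}(\mathbb F_q)$ (this set is exactly one class of matrices of rank $m-1$ modulo left units), and $\Phi\circ\sigma_\omega\circ\Phi^{-1}=\sigma_{\rho(\omega)}$ for every $\omega\in\mathcal O^\times$. -/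

import Mathlib

open scoped ValuativeRel TensorProduct

universe u v w

noncomputable section

namespace Metacommutation

/-! ### Reduced norm -/

section ReducedNorm

variable (K : Type u) [Field K] {B : Type v} [Ring B] [Algebra K B]

/-- `x` is the determinant of `1 ⊗ b` under a splitting `K̄ ⊗ B ≃ Mₙ(K̄)`. For a finite-dimensional
central simple algebra `B` such splittings exist, and neither `n` nor the determinant depends on
the choice. -/
def IsReducedNorm (b : B) (x : K) : Prop :=
  ∃ (n : ℕ) (φ : (AlgebraicClosure K ⊗[K] B) ≃ₐ[AlgebraicClosure K]
      Matrix (Fin n) (Fin n) (AlgebraicClosure K)),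
    algebraMap K (AlgebraicClosure K) x = (φ (1 ⊗ₜ[K] b)).det

open Classical in
/-- The reduced norm `nrd : B → K` of a central simple `K`-algebra. -/
def reducedNorm (b : B) : K :=
  if h : ∃ x : K, IsReducedNorm K b x then h.choose else 0

end ReducedNorm

/-! ### Orders and their left ideals -/

section Orders

variable {R : Type w} [CommRing R] (K : Type u) [Field K] [Algebra R K]
  {B : Type v} [Ring B] [Algebra R B] [Algebra K B] [IsScalarTower R K B]

/-- An `R`-order of `B`: a subring containing `R` that is a full `R`-lattice in `B`. -/
def IsOrder (O : Subalgebra R B) : Prop :=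
  (Subalgebra.toSubmodule O).IsLattice K

/-- An order that is not properly contained in another one. -/
def IsMaximalOrder (O : Subalgebra R B) : Prop :=
  Maximal (IsOrder K) O

variable {O : Subalgebra R B}

/-- The reduced norm of a left ideal `I` of `O`: the `R`-submodule of `K` generated by the reduced
norms of the elements of `I`. -/
def idealReducedNorm (I : Ideal O) : Submodule R K :=
  Submodule.span R {x : K | ∃ a ∈ I, x = reducedNorm K (a : B)}

variable (O) in
/-- `Id(O; 𝔭)`: the left ideals of `O` of reduced norm `𝔭`. -/
def IdealsOfNorm (p : Ideal R) : Type v :=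
  {P : Ideal O // idealReducedNorm K P = Submodule.map (Algebra.linearMap R K) p}

/-- The left ideal `P ω + O 𝔭`. -/
def metacomm (p : Ideal R) (ω : O) (P : Ideal O) : Ideal O :=
  Submodule.map (LinearMap.toSpanSingleton O O ω) P ⊔ Ideal.map (algebraMap R O) p

end Orders

/-! ### Matrices of corank one up to left units -/

section Matrices

variable {F : Type w} [Field F] {m : ℕ}

/-- Matrices of rank `m - 1` in `M_m(F)` (so that `m ≥ 1`). -/
def CorankOneMatrix (m : ℕ) (F : Type w) [Field F] : Type w :=
  {A : Matrix (Fin m) (Fin m) F // A.rank + 1 = m}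

/-- `A ∼ A'` if `A' = C A` for an invertible matrix `C`. -/
def leftUnitSetoid (m : ℕ) (F : Type w) [Field F] : Setoid (CorankOneMatrix m F) where
  r A A' := ∃ C : GL (Fin m) F, A'.1 = C.1 * A.1
  iseqv :=
    { refl := fun A => ⟨1, by simp⟩
      symm := by
        rintro A A' ⟨C, h⟩
        exact ⟨C⁻¹, by rw [h, ← mul_assoc, ← Units.val_mul]; simp⟩
      trans := by
        rintro A A' A'' ⟨C, h⟩ ⟨C', h'⟩
        exact ⟨C' * C, by rw [h', h, Units.val_mul, mul_assoc]⟩ }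

/-- `M_m^{(m-1)}`: matrices of rank `m - 1` up to left multiplication by units. -/
def CorankOneClasses (m : ℕ) (F : Type w) [Field F] : Type w :=
  Quotient (leftUnitSetoid m F)

/-- The class of a matrix of rank `m - 1`. -/
def CorankOneClasses.mk (A : Matrix (Fin m) (Fin m) F) (hA : A.rank + 1 = m) :
    CorankOneClasses m F :=
  Quotient.mk (leftUnitSetoid m F) ⟨A, hA⟩

theorem rank_mul_GL (A : Matrix (Fin m) (Fin m) F) (Q : GL (Fin m) F) :
    (A * Q.1).rank = A.rank :=
  Matrix.rank_mul_eq_left_of_isUnit_det _ _ ((Matrix.isUnit_iff_isUnit_det _).1 Q.isUnit)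

/-- The map `A ↦ A Q` on classes. -/
def sigmaMap (Q : GL (Fin m) F) : CorankOneClasses m F → CorankOneClasses m F :=
  Quotient.map (sa := leftUnitSetoid m F) (sb := leftUnitSetoid m F)
    (fun A => (⟨A.1 * Q.1, by rw [rank_mul_GL]; exact A.2⟩ : CorankOneMatrix m F))
    (by
      rintro A A' ⟨C, h⟩
      exact ⟨C, by simp only [h, mul_assoc]⟩)

theorem sigmaMap_sigmaMap (Q Q' : GL (Fin m) F) (h : Q * Q' = 1) (a : CorankOneClasses m F) :
    sigmaMap Q' (sigmaMap Q a) = a := by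
  induction a using Quotient.inductionOn with
  | h A =>
    refine congrArg (Quotient.mk (leftUnitSetoid m F)) (Subtype.ext ?_)
    change A.1 * Q.1 * Q'.1 = A.1
    rw [mul_assoc, ← Units.val_mul, h, Units.val_one, mul_one]

/-- The permutation `σ_Q : A ↦ A Q` of `M_m^{(m-1)}`. -/
def sigmaQ (Q : GL (Fin m) F) : Equiv.Perm (CorankOneClasses m F) where
  toFun := sigmaMap Q
  invFun := sigmaMap Q⁻¹
  left_inv := sigmaMap_sigmaMap Q Q⁻¹ (mul_inv_cancel Q)
  right_inv := sigmaMap_sigmaMap Q⁻¹ Q (inv_mul_cancel Q)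

end Matrices

/-- `ρ : S → M_m(F)` is reduction modulo the Jacobson radical of `S`, followed by an isomorphism
`S / rad S ≃ M_m(F)`. -/
def IsReduction {S : Type v} [Ring S] {m : ℕ} {F : Type w} [Field F]
    (ρ : S →+* Matrix (Fin m) (Fin m) F) : Prop :=
  Function.Surjective ρ ∧ RingHom.ker ρ = Ring.jacobson S

end Metacommutation

end

noncomputable section

namespace Metacommutation

/-! ### Left ideals of a matrix algebra over a field -/

section MatrixIdeals

variable {F : Type*} [Field F] {m : ℕ}

open Matrix

theorem mem_span_singleton_iff_ker (A X : Matrix (Fin m) (Fin m) F) :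
    X ∈ Ideal.span {A} ↔ ∀ u, A *ᵥ u = 0 → X *ᵥ u = 0 := by
  refine ⟨fun h u hu => ?_, fun h => ?_⟩
  · obtain ⟨Y, rfl⟩ := Ideal.mem_span_singleton'.1 h
    rw [← mulVec_mulVec, hu, mulVec_zero]
  · obtain ⟨e, he, hs⟩ := IsSemisimpleRing.ideal_eq_span_idempotent (Ideal.span {A})
    have hAe : A ∈ Ideal.span {e} := hs ▸ Ideal.mem_span_singleton_self A
    have heA : e ∈ Ideal.span {A} := hs ▸ Ideal.mem_span_singleton_self e
    obtain ⟨Y, hY⟩ := Ideal.mem_span_singleton'.1 hAe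
    have hX : X = X * e := by
      rw [← sub_eq_zero, ← mul_one_sub]
      refine Matrix.ext_of_mulVec_single fun i => ?_
      rw [← mulVec_mulVec, zero_mulVec]
      refine h _ ?_
      rw [mulVec_mulVec, mul_one_sub, ← hY, mul_assoc, he.eq, sub_self, zero_mulVec]
    rw [hX]
    exact Ideal.mul_mem_left _ _ heA

/-- The left ideal of matrices killing a vector. -/
def vecAnnihilator (v : Fin m → F) : Ideal (Matrix (Fin m) (Fin m) F) where
  carrier := {X | X *ᵥ v = 0}
  add_mem' := fun {a b} ha hb => by
    rw [Set.mem_ofPred_eq] at *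
    rw [add_mulVec, ha, hb, add_zero]
  zero_mem' := zero_mulVec v
  smul_mem' := fun c x hx => by
    rw [Set.mem_ofPred_eq] at *
    rw [smul_eq_mul, ← mulVec_mulVec, hx, mulVec_zero]

theorem mem_vecAnnihilator {v : Fin m → F} {X : Matrix (Fin m) (Fin m) F} :
    X ∈ vecAnnihilator v ↔ X *ᵥ v = 0 := Iff.rfl

theorem vecAnnihilator_ne_top {v : Fin m → F} (hv : v ≠ 0) : vecAnnihilator v ≠ ⊤ := by
  rw [Ne, Ideal.eq_top_iff_one, mem_vecAnnihilator, one_mulVec]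
  exact hv

theorem exists_mulVec_eq {v : Fin m → F} (hv : v ≠ 0) (u : Fin m → F) :
    ∃ X : Matrix (Fin m) (Fin m) F, X *ᵥ v = u := by
  obtain ⟨i, hi⟩ := Function.ne_iff.1 hv
  refine ⟨vecMulVec u (Pi.single i (v i)⁻¹), ?_⟩
  rw [vecMulVec_mulVec, single_dotProduct, inv_mul_cancel₀ hi]
  simp

theorem isMaximal_vecAnnihilator {v : Fin m → F} (hv : v ≠ 0) :
    (vecAnnihilator v).IsMaximal := by
  refine Ideal.isMaximal_iff.2 ⟨fun h => vecAnnihilator_ne_top hv ((Ideal.eq_top_iff_one _).2 h),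
    fun J X hJ hX hXJ => ?_⟩
  obtain ⟨Y, hY⟩ := exists_mulVec_eq (v := X *ᵥ v) hX v
  have h1 : 1 - Y * X ∈ vecAnnihilator v := by
    rw [mem_vecAnnihilator, sub_mulVec, one_mulVec, ← mulVec_mulVec, hY, sub_self]
  have := J.add_mem (hJ h1) (J.mul_mem_left Y hXJ)
  rwa [sub_add_cancel] at this

theorem exists_eq_vecAnnihilator {I : Ideal (Matrix (Fin m) (Fin m) F)} (hI : I.IsMaximal) :
    ∃ v : Fin m → F, v ≠ 0 ∧ I = vecAnnihilator v := by
  obtain ⟨e, he, rfl⟩ := IsSemisimpleRing.ideal_eq_span_idempotent I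
  have hdet : e.det = 0 := by
    by_contra h
    exact hI.ne_top (Ideal.eq_top_of_isUnit_mem _ (Ideal.mem_span_singleton_self e)
      ((Matrix.isUnit_iff_isUnit_det e).2 (isUnit_iff_ne_zero.2 h)))
  obtain ⟨v, hv, hev⟩ := exists_mulVec_eq_zero_iff.2 hdet
  refine ⟨v, hv, hI.eq_of_le (vecAnnihilator_ne_top hv) ?_⟩
  rw [Ideal.span_singleton_le_iff_mem]
  exact hev

theorem ker_eq_span_of_span_eq {A : Matrix (Fin m) (Fin m) F} {v : Fin m → F} (hv : v ≠ 0)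
    (h : Ideal.span {A} = vecAnnihilator v) : LinearMap.ker A.mulVecLin = F ∙ v := by
  have hA : A *ᵥ v = 0 := by
    rw [← mem_vecAnnihilator, ← h]
    exact Ideal.mem_span_singleton_self A
  refine le_antisymm (fun u hu => ?_) ?_
  · by_contra hun
    obtain ⟨i, hi⟩ := Function.ne_iff.1 hv
    let X : Matrix (Fin m) (Fin m) F := 1 - vecMulVec v (Pi.single i (v i)⁻¹)
    have hXu : ∀ u, X *ᵥ u = u - ((v i)⁻¹ * u i) • v := fun u => by
      rw [sub_mulVec, one_mulVec, vecMulVec_mulVec, single_dotProduct, op_smul_eq_smul]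
    have hX : X ∈ Ideal.span {A} := by
      rw [h, mem_vecAnnihilator, hXu, inv_mul_cancel₀ hi, one_smul, sub_self]
    have := (mem_span_singleton_iff_ker A X).1 hX u hu
    rw [hXu, sub_eq_zero] at this
    exact hun (this ▸ Submodule.smul_mem _ _ (Submodule.mem_span_singleton_self v))
  · rw [Submodule.span_singleton_le_iff_mem]
    exact hA

theorem finrank_ker_add_rank (A : Matrix (Fin m) (Fin m) F) :
    Module.finrank F (LinearMap.ker A.mulVecLin) + A.rank = m := by
  rw [add_comm]
  exact A.mulVecLin.finrank_range_add_finrank_ker.trans (by simp)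

theorem span_singleton_isMaximal_iff (A : Matrix (Fin m) (Fin m) F) :
    (Ideal.span {A}).IsMaximal ↔ A.rank + 1 = m := by
  have hr := finrank_ker_add_rank A
  refine ⟨fun h => ?_, fun h => ?_⟩
  · obtain ⟨v, hv, hI⟩ := exists_eq_vecAnnihilator h
    rw [ker_eq_span_of_span_eq hv hI, finrank_span_singleton hv] at hr
    omega
  · obtain ⟨v, hv, hspan⟩ := finrank_eq_one_iff'.1
      (show Module.finrank F (LinearMap.ker A.mulVecLin) = 1 by omega)
    have : Ideal.span {A} = vecAnnihilator (v : Fin m → F) := by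
      ext X
      rw [mem_span_singleton_iff_ker, mem_vecAnnihilator]
      refine ⟨fun h => h _ v.2, fun h u hu => ?_⟩
      obtain ⟨c, hc⟩ := hspan ⟨u, hu⟩
      have : u = c • (v : Fin m → F) := (congrArg Subtype.val hc).symm
      rw [this, mulVec_smul, h, smul_zero]
    rw [this]
    exact isMaximal_vecAnnihilator fun h => hv (Subtype.ext h)

theorem span_singleton_eq_iff_ker (A A' : Matrix (Fin m) (Fin m) F) :
    Ideal.span {A} = Ideal.span {A'} ↔
      LinearMap.ker A.mulVecLin = LinearMap.ker A'.mulVecLin := by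
  constructor
  · intro h
    ext u
    exact ⟨(mem_span_singleton_iff_ker A A').1 (h ▸ Ideal.mem_span_singleton_self A') u,
      (mem_span_singleton_iff_ker A' A).1 (h ▸ Ideal.mem_span_singleton_self A) u⟩
  · intro h
    ext X
    rw [mem_span_singleton_iff_ker, mem_span_singleton_iff_ker]
    exact forall_congr' fun u => imp_congr_left (SetLike.ext_iff.1 h u)

theorem exists_GL_mulVec (g : (Fin m → F) ≃ₗ[F] (Fin m → F)) :
    ∃ C : GL (Fin m) F, ∀ u, C.1 *ᵥ u = g u :=
  ⟨⟨LinearMap.toMatrix' g.toLinearMap, LinearMap.toMatrix' g.symm.toLinearMap,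
    by rw [← LinearMap.toMatrix'_comp]; simp, by rw [← LinearMap.toMatrix'_comp]; simp⟩,
    fun u => by simp [LinearMap.toMatrix'_mulVec]⟩

theorem span_singleton_eq_iff (A A' : Matrix (Fin m) (Fin m) F) :
    Ideal.span {A} = Ideal.span {A'} ↔ ∃ C : GL (Fin m) F, A' = C.1 * A := by
  rw [span_singleton_eq_iff_ker]
  constructor
  · intro h
    obtain ⟨g, hg⟩ := Submodule.exists_linearEquiv_restrict_eq
      (A.mulVecLin.quotKerEquivRange.symm ≪≫ₗ Submodule.quotEquivOfEq _ _ h ≪≫ₗ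
        A'.mulVecLin.quotKerEquivRange)
    obtain ⟨C, hC⟩ := exists_GL_mulVec g
    refine ⟨C, Matrix.ext_of_mulVec_single fun i => ?_⟩
    rw [← mulVec_mulVec, hC]
    have := hg ⟨A *ᵥ Pi.single i 1, LinearMap.mem_range_self A.mulVecLin _⟩
    rw [← this]
    have h2 : (⟨A *ᵥ Pi.single i 1, LinearMap.mem_range_self A.mulVecLin _⟩ :
        LinearMap.range A.mulVecLin) =
        A.mulVecLin.quotKerEquivRange (Submodule.Quotient.mk (Pi.single i 1)) := rfl
    rw [h2, LinearEquiv.trans_apply, LinearEquiv.trans_apply, LinearEquiv.symm_apply_apply]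
    rfl
  · rintro ⟨C, rfl⟩
    ext u
    simp only [LinearMap.mem_ker, mulVecLin_apply, ← mulVec_mulVec]
    refine ⟨fun h => by rw [h, mulVec_zero], fun h => ?_⟩
    have := congrArg (fun x => (C⁻¹).1 *ᵥ x) h
    simpa only [mulVec_mulVec, ← mul_assoc, ← Units.val_mul, inv_mul_cancel, Units.val_one,
      one_mul, mulVec_zero] using this

theorem exists_GL_mulVec_eq {v v' : Fin m → F} (hv : v ≠ 0) (hv' : v' ≠ 0) :
    ∃ C : GL (Fin m) F, C.1 *ᵥ v = v' := by
  obtain ⟨g, hg⟩ := Submodule.exists_linearEquiv_restrict_eq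
    ((LinearEquiv.toSpanNonzeroSingleton F _ v hv).symm ≪≫ₗ
      LinearEquiv.toSpanNonzeroSingleton F _ v' hv')
  obtain ⟨C, hC⟩ := exists_GL_mulVec g
  refine ⟨C, ?_⟩
  have h := hg (LinearEquiv.toSpanNonzeroSingleton F _ v hv 1)
  rw [LinearEquiv.trans_apply, LinearEquiv.symm_apply_apply] at h
  rw [hC]
  simpa using h.symm

end MatrixIdeals

/-! ### The determinant of right multiplication -/

section RightNorm

/-- The determinant of right multiplication by `x`. -/
def rightNorm (K : Type*) [CommRing K] {A : Type*} [Ring A] [Algebra K A] (x : A) : K :=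
  LinearMap.det (LinearMap.mulRight K x)

variable {K : Type*} [Field K] {A : Type*} [Ring A] [Algebra K A]

theorem rightNorm_one : rightNorm K (1 : A) = 1 := by
  rw [rightNorm, LinearMap.mulRight_one, LinearMap.det_id]

theorem rightNorm_mul (x y : A) : rightNorm K (x * y) = rightNorm K x * rightNorm K y := by
  rw [rightNorm, LinearMap.mulRight_mul, LinearMap.det_comp, mul_comm]
  rfl

theorem rightNorm_algebraMap (c : K) :
    rightNorm K (algebraMap K A c) = c ^ Module.finrank K A := by
  have : LinearMap.mulRight K (algebraMap K A c) = c • LinearMap.id := by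
    ext x
    simp [Algebra.smul_def, Algebra.commutes]
  rw [rightNorm, this, LinearMap.det_smul, LinearMap.det_id, mul_one]

theorem rightNorm_pow (x : A) (k : ℕ) : rightNorm K (x ^ k) = rightNorm K x ^ k := by
  induction k with
  | zero => rw [pow_zero, pow_zero, rightNorm_one]
  | succ k ih => rw [pow_succ, pow_succ, rightNorm_mul, ih]

theorem rightNorm_smul (c : K) (x : A) :
    rightNorm K (c • x) = c ^ Module.finrank K A * rightNorm K x := by
  rw [Algebra.smul_def, rightNorm_mul, rightNorm_algebraMap]

theorem rightNorm_algEquiv {A' : Type*} [Ring A'] [Algebra K A'] (e : A ≃ₐ[K] A') (x : A) :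
    rightNorm K (e x) = rightNorm K x := by
  rw [rightNorm, rightNorm, ← LinearMap.det_conj (LinearMap.mulRight K x) e.toLinearEquiv]
  congr 1
  ext y
  simp

theorem rightNorm_tmul (L : Type*) [Field L] [Algebra K L] [FiniteDimensional K A] (x : A) :
    rightNorm L ((1 : L) ⊗ₜ[K] x) = algebraMap K L (rightNorm K x) := by
  rw [rightNorm, rightNorm, ← LinearMap.det_baseChange]
  congr 1
  ext y
  simp

theorem rightNorm_matrix {n : ℕ} (M : Matrix (Fin n) (Fin n) K) : rightNorm K M = M.det ^ n := by
  have h := LinearMap.det_pi (fun _ : Fin n => M.vecMulLinear)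
  have h2 : LinearMap.det M.vecMulLinear = M.det := by
    rw [← Matrix.det_transpose, ← LinearMap.det_toLin']
    congr 1
    ext
    simp
  rw [Finset.prod_const, Finset.card_univ, Fintype.card_fin, h2] at h
  rw [← h]
  rfl

theorem IsReducedNorm.pow_eq [FiniteDimensional K A] {b : A} {x : K} (h : IsReducedNorm K b x) :
    x ^ (Module.finrank K A).sqrt = rightNorm K b := by
  obtain ⟨n, φ, hφ⟩ := h
  have hn : Module.finrank K A = n * n := by
    rw [← Module.finrank_baseChange (R := AlgebraicClosure K), φ.toLinearEquiv.finrank_eq]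
    simp [Module.finrank_matrix]
  apply (algebraMap K (AlgebraicClosure K)).injective
  rw [hn, Nat.sqrt_eq, map_pow, hφ, ← rightNorm_matrix, rightNorm_algEquiv, rightNorm_tmul]

theorem IsReducedNorm.reducedNorm {b : A} {x : K} (h : IsReducedNorm K b x) :
    IsReducedNorm K b (reducedNorm K b) := by
  have h' : ∃ x : K, IsReducedNorm K b x := ⟨x, h⟩
  rw [Metacommutation.reducedNorm, dif_pos h']
  exact h'.choose_spec

theorem reducedNorm_eq_zero_or (b : A) :
    reducedNorm K b = 0 ∨ IsReducedNorm K b (reducedNorm K b) := by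
  by_cases h : ∃ x : K, IsReducedNorm K b x
  · exact Or.inr h.choose_spec.reducedNorm
  · exact Or.inl (dif_neg h)

theorem IsReducedNorm.algEquiv {A' : Type*} [Ring A'] [Algebra K A'] (e : A ≃ₐ[K] A') {b : A}
    {x : K} (h : IsReducedNorm K b x) : IsReducedNorm K (e b) x := by
  obtain ⟨n, φ, hφ⟩ := h
  refine ⟨n, (Algebra.TensorProduct.congr AlgEquiv.refl e).symm.trans φ, ?_⟩
  rw [hφ, AlgEquiv.trans_apply]
  congr 2
  rw [AlgEquiv.eq_symm_apply]
  simp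

theorem IsReducedNorm.conj {b : A} {x : K} (h : IsReducedNorm K b x) (u : Aˣ) :
    IsReducedNorm K (u.inv * b * u) x := by
  obtain ⟨n, φ, hφ⟩ := h
  refine ⟨n, φ, ?_⟩
  have h1 : (1 : AlgebraicClosure K) ⊗ₜ[K] (u.inv * b * u.val) =
      (1 ⊗ₜ u.inv) * (1 ⊗ₜ b) * (1 ⊗ₜ u.val) := by simp
  have h2 : (φ (1 ⊗ₜ u.val)).det * (φ ((1 : AlgebraicClosure K) ⊗ₜ[K] u.inv)).det = 1 := by
    rw [← Matrix.det_mul, ← map_mul, Algebra.TensorProduct.tmul_mul_tmul, u.val_inv, one_mul,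
      ← Algebra.TensorProduct.one_def, map_one, Matrix.det_one]
  rw [h1, map_mul, map_mul, Matrix.det_mul, Matrix.det_mul, hφ]
  linear_combination -(φ (1 ⊗ₜ b)).det * h2

end RightNorm

/-! ### Splitting a central division algebra -/

section Splitting

variable (K : Type*) [Field K] (D : Type*) [DivisionRing D] [Algebra K D] [Algebra.IsCentral K D]
  (L : Type*) [Field L] [Algebra K L]

open Algebra.TensorProduct in
theorem isSimpleRing_tensorProduct : IsSimpleRing (D ⊗[K] L) := by
  rw [isSimpleRing_iff_isTwoSided_imp]
  refine ⟨inferInstance, fun I hI => or_iff_not_imp_left.2 fun hne => ?_⟩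
  let ℓ := Module.Basis.ofVectorSpace K L
  let β := Algebra.TensorProduct.basis D ℓ
  have hβ : ∀ (x : D ⊗[K] L) (d : D) i, β.repr (x * d ⊗ₜ 1) i = β.repr x i * d := by
    intro x d i
    induction x using TensorProduct.induction_on with
    | zero => simp
    | add x y hx hy => rw [add_mul, map_add, Finsupp.add_apply, hx, hy, map_add,
        Finsupp.add_apply, add_mul]
    | tmul a l =>
      rw [tmul_mul_tmul, mul_one, basis_repr_tmul, basis_repr_tmul]
      simp [mul_assoc, Algebra.commutes]
  have hβ' : ∀ (x : D ⊗[K] L) (d : D) i, β.repr (d ⊗ₜ 1 * x) i = d * β.repr x i := by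
    intro x d i
    have : d ⊗ₜ[K] (1 : L) * x = d • x := by
      induction x using TensorProduct.induction_on with
      | zero => simp
      | add x y hx hy => rw [mul_add, hx, hy, smul_add]
      | tmul a l => rw [tmul_mul_tmul, one_mul, TensorProduct.smul_tmul', smul_eq_mul]
    rw [this, map_smul, Finsupp.smul_apply, smul_eq_mul]
  have key : ∀ (k : ℕ) (x : D ⊗[K] L), x ∈ I → x ≠ 0 → (β.repr x).support.card = k →
      I = ⊤ := by
    intro k
    induction k using Nat.strong_induction_on with
    | _ k ih =>
    intro x hx hx0 hk
    obtain ⟨i, hi⟩ : ∃ i, β.repr x i ≠ 0 := by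
      by_contra! h
      exact hx0 (β.repr.map_eq_zero_iff.1 (Finsupp.ext h))
    let y := (β.repr x i)⁻¹ ⊗ₜ[K] (1 : L) * x
    have hy : y ∈ I := I.mul_mem_left _ hx
    have hyi : β.repr y i = 1 := by rw [hβ', inv_mul_cancel₀ hi]
    by_cases hc : ∀ (d : D), y * d ⊗ₜ 1 - d ⊗ₜ 1 * y = 0
    · have hK : ∀ j, ∃ c : K, β.repr y j = algebraMap K D c := fun j => by
        rw [← Algebra.IsCentral.mem_center_iff, Subalgebra.mem_center_iff]
        intro d
        have := congrArg (fun z => β.repr z j) (hc d)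
        simp only [map_sub, Finsupp.sub_apply, hβ, hβ', map_zero, Finsupp.zero_apply] at this
        exact (sub_eq_zero.1 this).symm
      choose c hcK using hK
      have hyl : y = 1 ⊗ₜ[K] ((β.repr y).sum fun j _ => c j • ℓ j) := by
        rw [Finsupp.sum, TensorProduct.tmul_sum]
        conv_lhs => rw [← β.linearCombination_repr y, Finsupp.linearCombination_apply,
          Finsupp.sum]
        refine Finset.sum_congr rfl fun j _ => ?_
        rw [hcK, algebraMap_smul, basis_apply, TensorProduct.tmul_smul]
      set l := (β.repr y).sum fun j _ => c j • ℓ j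
      have hl : l ≠ 0 := by
        intro h
        rw [hyl, h, TensorProduct.tmul_zero, map_zero, Finsupp.zero_apply] at hyi
        exact zero_ne_one hyi
      refine (Ideal.eq_top_iff_one _).2 ?_
      have := I.mul_mem_left (1 ⊗ₜ l⁻¹) hy
      rwa [hyl, tmul_mul_tmul, one_mul, inv_mul_cancel₀ hl] at this
    · push Not at hc
      obtain ⟨d, hd⟩ := hc
      refine ih _ ?_ _ (I.sub_mem (I.mul_mem_right _ hy) (I.mul_mem_left _ hy)) hd rfl
      rw [← hk]
      refine Finset.card_lt_card ((Finset.ssubset_iff_of_subset fun j hj => ?_).2 ⟨i, ?_, ?_⟩)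
      · rw [Finsupp.mem_support_iff] at *
        intro h
        apply hj
        rw [map_sub, Finsupp.sub_apply, hβ, hβ' y, hβ' x, h, mul_zero, zero_mul, mul_zero,
          sub_zero]
      · exact Finsupp.mem_support_iff.2 hi
      · rw [Finsupp.notMem_support_iff, map_sub, Finsupp.sub_apply, hβ, hβ' y, hyi, one_mul,
          mul_one, sub_self]
  obtain ⟨x, hx, hx0⟩ := I.ne_bot_iff.1 hne
  exact key _ x hx hx0 rfl

theorem exists_splitting [FiniteDimensional K D] : ∃ n : ℕ, n * n = Module.finrank K D ∧
    Nonempty ((AlgebraicClosure K ⊗[K] D) ≃ₐ[AlgebraicClosure K]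
      Matrix (Fin n) (Fin n) (AlgebraicClosure K)) := by
  have : IsSimpleRing (AlgebraicClosure K ⊗[K] D) :=
    .of_ringEquiv (Algebra.TensorProduct.comm K D (AlgebraicClosure K)).toRingEquiv
      (isSimpleRing_tensorProduct K D _)
  obtain ⟨n, _, ⟨φ⟩⟩ := IsSimpleRing.exists_algEquiv_matrix_of_isAlgClosed
    (AlgebraicClosure K) (AlgebraicClosure K ⊗[K] D)
  refine ⟨n, ?_, ⟨φ⟩⟩
  rw [← Module.finrank_baseChange (R := AlgebraicClosure K), φ.toLinearEquiv.finrank_eq]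
  simp [Module.finrank_matrix]

end Splitting

section MinpolyOfSplitting

variable {K : Type*} [Field K] {D : Type*} [DivisionRing D] [Algebra K D]
  (L : Type*) [Field L] [Algebra K L]

theorem natDegree_minpoly_le_tmul [FiniteDimensional K D] (a : D) :
    (minpoly K a).natDegree ≤ (minpoly L ((1 : L) ⊗ₜ[K] a)).natDegree := by
  have hli := Module.Flat.linearIndependent_one_tmul (S := L) (linearIndependent_pow (K := K) a)
  by_contra! hlt
  set q := minpoly L ((1 : L) ⊗ₜ[K] a)
  have hint : IsIntegral L ((1 : L) ⊗ₜ[K] a) := .of_finite L _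
  have h0 : Polynomial.aeval ((1 : L) ⊗ₜ[K] a) q = 0 := minpoly.aeval _ _
  rw [Polynomial.aeval_eq_sum_range' hlt, ← Fin.sum_univ_eq_sum_range
    (fun i => q.coeff i • ((1 : L) ⊗ₜ[K] a) ^ i)] at h0
  have := Fintype.linearIndependent_iff.1 hli (fun i => q.coeff i)
    (by simpa [Algebra.TensorProduct.tmul_pow] using h0) ⟨q.natDegree, hlt⟩
  have hm : q.coeff q.natDegree = 1 := minpoly.monic hint
  rw [hm] at this
  exact one_ne_zero this

theorem natDegree_minpoly_le_of_splitting [FiniteDimensional K D] {n : ℕ}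
    (φ : (L ⊗[K] D) ≃ₐ[L] Matrix (Fin n) (Fin n) L) (a : D) :
    (minpoly K a).natDegree ≤ n := by
  refine (natDegree_minpoly_le_tmul L a).trans ?_
  rw [← minpoly.algEquiv_eq φ]
  have h := Polynomial.natDegree_le_of_dvd (Matrix.minpoly_dvd_charpoly (φ (1 ⊗ₜ a)))
    (Matrix.charpoly_monic _).ne_zero
  rwa [Matrix.charpoly_natDegree_eq_dim, Fintype.card_fin] at h

theorem det_splitting_of_natDegree_minpoly [FiniteDimensional K D] {n : ℕ}
    (φ : (L ⊗[K] D) ≃ₐ[L] Matrix (Fin n) (Fin n) L) (a : D)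
    (h : n ≤ (minpoly K a).natDegree) :
    ∃ x : K, algebraMap K L x = (φ (1 ⊗ₜ a)).det := by
  have hint : IsIntegral L ((1 : L) ⊗ₜ[K] a) := .of_finite L _
  have h0 := h.trans (natDegree_minpoly_le_tmul L a)
  have h1 : (φ (1 ⊗ₜ a)).charpoly = minpoly L ((1 : L) ⊗ₜ[K] a) := by
    refine Polynomial.eq_of_monic_of_dvd_of_natDegree_le (minpoly.monic hint)
      (Matrix.charpoly_monic _) ?_ ?_
    · rw [← minpoly.algEquiv_eq φ]
      exact Matrix.minpoly_dvd_charpoly _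
    · rw [Matrix.charpoly_natDegree_eq_dim, Fintype.card_fin]
      exact h0
  have h2 : (minpoly K a).map (algebraMap K L) = minpoly L ((1 : L) ⊗ₜ[K] a) := by
    refine Polynomial.eq_of_monic_of_dvd_of_natDegree_le (minpoly.monic hint)
      ((minpoly.monic (.of_finite K a)).map _) (minpoly.dvd _ _ ?_) ?_
    · have := congrArg (Algebra.TensorProduct.includeRight (R := K) (A := L)) (minpoly.aeval K a)
      rw [map_zero, ← Polynomial.aeval_algHom_apply] at this
      rw [Polynomial.aeval_map_algebraMap]
      exact this
    · rw [Polynomial.natDegree_map]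
      exact natDegree_minpoly_le_tmul L a
  refine ⟨(-1) ^ n * (minpoly K a).coeff 0, ?_⟩
  rw [Matrix.det_eq_sign_charpoly_coeff, h1, ← h2, Polynomial.coeff_map, Fintype.card_fin]
  simp

theorem det_comp_diagonal {R : Type*} [CommRing R] {m n : Type*} [Fintype m] [DecidableEq m]
    [Fintype n] [DecidableEq n] (f : m → Matrix n n R) :
    (Matrix.comp m m n n R (Matrix.diagonal f)).det = ∏ i, (f i).det := by
  rw [← Matrix.det_blockDiagonal, ← Matrix.det_submatrix_equiv_self (Equiv.prodComm n m)]
  congr 1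
  ext ⟨k, i⟩ ⟨l, j⟩
  by_cases h : i = j
  · subst h
    simp [Matrix.blockDiagonal_apply]
  · simp [Matrix.blockDiagonal_apply, h]

/-- The reduced norm of `diag(a, 1, …, 1)` is that of `a`. -/
theorem IsReducedNorm.diagonal {a : D} {x : K} (h : IsReducedNorm K a x) {m : ℕ} (i : Fin m) :
    IsReducedNorm K (Matrix.diagonal (Function.update (1 : Fin m → D) i a)) x := by
  obtain ⟨n, φ, hφ⟩ := h
  let L := AlgebraicClosure K
  let e₁ : (L ⊗[K] Matrix (Fin m) (Fin m) D) ≃ₐ[L] Matrix (Unit × Fin m) (Unit × Fin m) (L ⊗[K] D) :=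
    (Algebra.TensorProduct.congr (Matrix.uniqueAlgEquiv (R := L) (A := L) (m := Unit)).symm
      AlgEquiv.refl).trans (Matrix.kroneckerTMulAlgEquiv Unit (Fin m) K L L D)
  let e₂ := e₁.trans (φ.mapMatrix.trans (Matrix.compAlgEquiv (Unit × Fin m) (Fin n) L L))
  let e₃ := e₂.trans (Matrix.reindexAlgEquiv L L (Fintype.equivFin ((Unit × Fin m) × Fin n)))
  have h₁ : e₁ (1 ⊗ₜ Matrix.diagonal (Function.update (1 : Fin m → D) i a)) =
      Matrix.diagonal fun j => 1 ⊗ₜ Function.update (1 : Fin m → D) i a j.2 := by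
    ext ⟨k, j⟩ ⟨k', j'⟩
    by_cases hj : j = j'
    · subst hj
      simp [e₁, Matrix.kroneckerMap_apply]
    · simp [e₁, Matrix.kroneckerMap_apply, hj]
  refine ⟨_, e₃, ?_⟩
  rw [AlgEquiv.trans_apply, Matrix.coe_reindexAlgEquiv, Matrix.det_reindex_self,
    AlgEquiv.trans_apply, h₁, AlgEquiv.trans_apply, AlgEquiv.mapMatrix_apply,
    Matrix.diagonal_map (map_zero φ), Matrix.compAlgEquiv_apply, det_comp_diagonal, hφ,
    Fintype.prod_prod_type, Fintype.prod_unique, Finset.prod_eq_single i]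
  · simp
  · intro j _ hj
    simp only [Function.update_of_ne hj, Pi.one_apply,
      ← Algebra.TensorProduct.one_def, map_one, Matrix.det_one]
  · simp

end MinpolyOfSplitting

/-! ### Bounded sets in a local field -/

section Bounded

open ValuativeRel

variable {K : Type*} [Field K] [ValuativeRel K] [TopologicalSpace K]

theorem isOpen_valuation_lt [IsValuativeTopology K] (γ : ValueGroupWithZero K) :
    IsOpen {x : K | valuation K x < γ} := by
  refine isOpen_iff_mem_nhds.2 fun x hx => ?_
  rw [Set.mem_ofPred_eq] at hx
  refine IsValuativeTopology.mem_nhds_iff'.2 ⟨Units.mk0 γ (zero_le.trans_lt hx).ne', ?_⟩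
  intro z hz
  rw [Set.mem_ofPred_eq] at *
  have := (valuation K).map_add_lt hz hx
  rwa [sub_add_cancel] at this

variable [IsNonarchimedeanLocalField K]

instance : MulArchimedean (ValueGroupWithZero K) :=
  isRankLeOne_iff_mulArchimedean.1 inferInstance

theorem exists_valuation_le_of_isCompact {S : Set K} (hS : IsCompact S) :
    ∃ γ : ValueGroupWithZero K, 1 ≤ γ ∧ ∀ x ∈ S, valuation K x ≤ γ := by
  obtain ⟨g, hg⟩ : ∃ g : ValueGroupWithZero K, 1 < g := by
    obtain ⟨x, hx0, hx1⟩ := Valuation.IsNontrivial.exists_lt_one (v := valuation K)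
    exact ⟨(valuation K x)⁻¹, (one_lt_inv₀ (zero_lt_iff.2 ((valuation K).ne_zero_iff.2 hx0))).2 hx1⟩
  have hmono : Monotone fun k : ℕ => g ^ k := fun i j hij => pow_le_pow_right₀ hg.le hij
  obtain ⟨k, hk⟩ := hS.elim_directed_cover (fun k : ℕ => {x : K | valuation K x < g ^ k})
    (fun k => isOpen_valuation_lt _)
    (fun x _ => by
      obtain ⟨k, hk⟩ := MulArchimedean.arch (valuation K x) hg
      exact Set.mem_iUnion.2 ⟨k + 1, hk.trans_lt (pow_lt_pow_right₀ hg k.lt_succ_self)⟩)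
    (fun i j => ⟨max i j, fun x hx => lt_of_lt_of_le hx (hmono (le_max_left i j)),
      fun x hx => lt_of_lt_of_le hx (hmono (le_max_right i j))⟩)
  refine ⟨g ^ k, one_le_pow₀ hg.le, fun x hx => le_of_lt ?_⟩
  exact hk hx

theorem le_one_of_forall_pow_le {x δ : ValueGroupWithZero K} (h : ∀ k : ℕ, x ^ k ≤ δ) :
    x ≤ 1 := by
  by_contra! hx
  obtain ⟨k, hk⟩ := MulArchimedean.arch δ hx
  exact (h (k + 1)).not_gt (hk.trans_lt (pow_lt_pow_right₀ hx k.lt_succ_self))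

omit [TopologicalSpace K] [IsNonarchimedeanLocalField K] in
theorem exists_primitive_multiple {ι : Type*} [Finite ι] {c : ι → K} (hc : c ≠ 0) :
    ∃ s : K, s ≠ 0 ∧ (∀ i, valuation K (s * c i) ≤ 1) ∧ ∃ i, s * c i = 1 := by
  obtain ⟨j, hj⟩ := Function.ne_iff.1 hc
  have : Nonempty ι := ⟨j⟩
  obtain ⟨i, hi⟩ := Finite.exists_max fun i => valuation K (c i)
  have hi0 : c i ≠ 0 := fun h => by
    have := hi j
    simp only [h, map_zero, le_zero_iff, map_eq_zero] at this
    exact hj this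
  refine ⟨(c i)⁻¹, inv_ne_zero hi0, fun k => ?_, i, inv_mul_cancel₀ hi0⟩
  rw [map_mul, map_inv₀]
  exact inv_mul_le_one_of_le₀ (hi k) zero_le

variable {A : Type*} [Ring A] [Algebra K A] {ι : Type*} [Fintype ι]

omit [ValuativeRel K] [IsNonarchimedeanLocalField K] in
theorem continuous_rightNorm [IsTopologicalRing K] (b : Module.Basis ι K A) :
    Continuous fun c : ι → K => rightNorm K (b.equivFun.symm c) := by
  classical
  have h : (fun c : ι → K => rightNorm K (b.equivFun.symm c)) =
      fun c => (∑ i, c i • LinearMap.toMatrix b b (LinearMap.mulRight K (b i))).det := by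
    funext c
    rw [rightNorm, ← LinearMap.det_toMatrix b, Module.Basis.equivFun_symm_apply]
    congr 1
    rw [show LinearMap.mulRight K (∑ i, c i • b i) = ∑ i, c i • LinearMap.mulRight K (b i) by
      ext y; simp [Finset.mul_sum], map_sum]
    simp only [map_smul]
  rw [h]
  refine Continuous.matrix_det ?_
  fun_prop

/-- Elements whose coordinates have bounded valuation. -/
def boundedBy (b : Module.Basis ι K A) (γ : ValueGroupWithZero K) : AddSubmonoid A where
  carrier := {x | ∀ i, valuation K (b.equivFun x i) ≤ γ}
  add_mem' := fun {x y} hx hy i => by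
    rw [map_add, Pi.add_apply]
    exact (valuation K).map_add_le (hx i) (hy i)
  zero_mem' := fun i => by simp

theorem exists_rightNorm_le (b : Module.Basis ι K A) (γ : ValueGroupWithZero K) :
    ∃ δ : ValueGroupWithZero K, ∀ x ∈ boundedBy b γ, valuation K (rightNorm K x) ≤ δ := by
  have hc : IsCompact (Set.univ.pi fun _ : ι => {x : K | valuation K x ≤ γ}) :=
    isCompact_univ_pi fun _ => IsNonarchimedeanLocalField.isCompact_closedBall K γ
  obtain ⟨δ, -, hδ⟩ := exists_valuation_le_of_isCompact (hc.image (continuous_rightNorm b))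
  refine ⟨δ, fun x hx => hδ _ ⟨b.equivFun x, fun i _ => hx i, ?_⟩⟩
  simp only [LinearEquiv.symm_apply_apply]

end Bounded

/-! ### The valuation of a division algebra over a local field -/

section DivisionValuation

open ValuativeRel

variable (K : Type*) [Field K] [ValuativeRel K] [TopologicalSpace K]
  [IsNonarchimedeanLocalField K] {D : Type*} [DivisionRing D] [Algebra K D]

theorem rightNorm_ne_zero {K : Type*} [Field K] {D : Type*} [DivisionRing D] [Algebra K D]
    {x : D} (hx : x ≠ 0) : rightNorm K x ≠ 0 := by
  intro h
  have := rightNorm_mul (K := K) x x⁻¹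
  rw [mul_inv_cancel₀ hx, rightNorm_one, h, zero_mul] at this
  exact one_ne_zero this

variable [FiniteDimensional K D]

theorem rightNorm_zero {K : Type*} [Field K] {D : Type*} [DivisionRing D] [Algebra K D]
    [FiniteDimensional K D] : rightNorm K (0 : D) = 0 := by
  rw [← map_zero (algebraMap K D), rightNorm_algebraMap, zero_pow Module.finrank_pos.ne']

theorem exists_mem_boundedBy_of_rightNorm_le_one {ι : Type*} [Fintype ι]
    (b : Module.Basis ι K D) : ∃ γ : ValueGroupWithZero K, ∀ x : D,
      valuation K (rightNorm K x) ≤ 1 → x ∈ boundedBy b γ := by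
  let S : Set (ι → K) := (Set.univ.pi fun _ : ι => {x : K | valuation K x ≤ 1}) ∩
    ⋃ i, (fun c => c i) ⁻¹' {x : K | valuation K x < 1}ᶜ
  have hS : IsCompact S := by
    refine (isCompact_univ_pi fun _ =>
      IsNonarchimedeanLocalField.isCompact_closedBall K 1).inter_right ?_
    exact isClosed_iUnion_of_finite fun i =>
      (isOpen_valuation_lt 1).isClosed_compl.preimage (continuous_apply i)
  have h0 : ∀ c ∈ S, rightNorm K (b.equivFun.symm c) ≠ 0 := by
    rintro c ⟨-, hc⟩
    obtain ⟨i, hi⟩ := Set.mem_iUnion.1 hc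
    refine rightNorm_ne_zero fun h => hi ?_
    rw [LinearEquiv.map_eq_zero_iff] at h
    simp [h]
  obtain ⟨γ, hγ1, hγ⟩ := exists_valuation_le_of_isCompact (hS.image_of_continuousOn
    ((continuous_rightNorm b).continuousOn.inv₀ h0))
  refine ⟨γ, fun x hx => ?_⟩
  rcases eq_or_ne x 0 with rfl | hx0
  · exact zero_mem _
  obtain ⟨s, hs0, hs1, i, hi⟩ := exists_primitive_multiple (c := b.equivFun x)
    (fun h => hx0 (b.equivFun.map_eq_zero_iff.1 h))
  have hsS : b.equivFun (s • x) ∈ S := by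
    refine ⟨fun j _ => ?_, Set.mem_iUnion.2 ⟨i, ?_⟩⟩
    · rw [map_smul]
      exact hs1 j
    · rw [map_smul]
      change ¬ valuation K (s * b.equivFun x i) < 1
      rw [hi, map_one]
      exact lt_irrefl 1
  have hb : valuation K (rightNorm K (b.equivFun.symm (b.equivFun (s • x))))⁻¹ ≤ γ :=
    hγ _ ⟨_, hsS, rfl⟩
  rw [LinearEquiv.symm_apply_apply, rightNorm_smul] at hb
  have hvs : 0 < valuation K s := zero_lt_iff.2 ((valuation K).ne_zero_iff.2 hs0)
  have hinv : (valuation K s)⁻¹ ≤ γ := by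
    rcases le_total 1 (valuation K s) with h1 | h1
    · exact (inv_le_one_of_one_le₀ h1).trans hγ1
    · have h2 : valuation K (s ^ Module.finrank K D * rightNorm K x) ≤ valuation K s := by
        rw [map_mul, map_pow]
        exact (mul_le_of_le_one_right' hx).trans
          (pow_le_of_le_one zero_le h1 Module.finrank_pos.ne')
      refine le_trans ?_ hb
      rw [map_inv₀]
      refine inv_anti₀ ?_ h2
      rw [zero_lt_iff, Valuation.ne_zero_iff]
      exact mul_ne_zero (pow_ne_zero _ hs0) (rightNorm_ne_zero hx0)
  intro j
  refine le_trans ?_ hinv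
  rw [← one_div, le_div_iff₀' hvs, ← map_mul]
  exact hs1 j

theorem valuation_rightNorm_one_add_le {x : D} (hx : valuation K (rightNorm K x) ≤ 1) :
    valuation K (rightNorm K (1 + x)) ≤ 1 := by
  let b := Module.finBasis K D
  obtain ⟨γ, hγ⟩ := exists_mem_boundedBy_of_rightNorm_le_one K b
  obtain ⟨δ, hδ⟩ := exists_rightNorm_le b γ
  refine le_one_of_forall_pow_le (δ := δ) fun k => ?_
  rw [← map_pow, ← rightNorm_pow]
  refine hδ _ ?_
  rw [add_comm, (Commute.one_right x).add_pow]
  refine sum_mem fun i _ => ?_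
  rw [one_pow, mul_one, ← nsmul_eq_mul']
  refine nsmul_mem (hγ _ ?_) _
  rw [rightNorm_pow, map_pow]
  exact pow_le_one₀ zero_le hx

variable (D) in
/-- The valuation `x ↦ v (N x)` of a division algebra over a local field, where `N` is the
determinant of right multiplication. -/
def divisionValuation : Valuation D (WithZero (Multiplicative ℤ)) :=
  Valuation.map ⟨⟨IsNonarchimedeanLocalField.valueGroupWithZeroIsoInt K, map_zero _⟩, map_one _, map_mul _⟩
    (OrderIsoClass.toOrderIso (IsNonarchimedeanLocalField.valueGroupWithZeroIsoInt K)).monotone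
  { toFun := fun x => valuation K (rightNorm K x)
    map_zero' := by rw [rightNorm_zero, map_zero]
    map_one' := by rw [rightNorm_one, map_one]
    map_mul' := fun x y => by rw [rightNorm_mul, map_mul]
    map_add_le_max' := by
      have key : ∀ x y : D, valuation K (rightNorm K x) ≤ valuation K (rightNorm K y) →
          valuation K (rightNorm K (x + y)) ≤ valuation K (rightNorm K y) := by
        intro x y h
        rcases eq_or_ne y 0 with rfl | hy
        · rw [rightNorm_zero, map_zero, le_zero_iff, Valuation.zero_iff] at h
          rcases eq_or_ne x 0 with rfl | hx
          · rw [add_zero]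
          · exact absurd h (rightNorm_ne_zero hx)
        · have hN := rightNorm_ne_zero (K := K) hy
          have hxy : x + y = (1 + x * y⁻¹) * y := by
            rw [add_mul, one_mul, inv_mul_cancel_right₀ hy, add_comm]
          rw [hxy, rightNorm_mul, map_mul]
          refine mul_le_of_le_one_left' (valuation_rightNorm_one_add_le K ?_)
          have h2 := rightNorm_mul (K := K) (x * y⁻¹) y
          rw [inv_mul_cancel_right₀ hy] at h2
          rw [h2, map_mul] at h
          exact (mul_le_iff_le_one_left (zero_lt_iff.2 ((valuation K).ne_zero_iff.2 hN))).1 h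
      intro x y
      rcases le_total (valuation K (rightNorm K x)) (valuation K (rightNorm K y)) with h | h
      · exact le_max_of_le_right (key x y h)
      · rw [add_comm]
        exact le_max_of_le_left (key y x h) }

theorem divisionValuation_apply (x : D) : divisionValuation K D x =
    IsNonarchimedeanLocalField.valueGroupWithZeroIsoInt K (valuation K (rightNorm K x)) := rfl

theorem divisionValuation_le_one_iff {x : D} :
    divisionValuation K D x ≤ 1 ↔ valuation K (rightNorm K x) ≤ 1 := by
  rw [divisionValuation_apply, ← map_one (IsNonarchimedeanLocalField.valueGroupWithZeroIsoInt K),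
    map_le_map_iff]

theorem divisionValuation_algebraMap (c : K) : divisionValuation K D (algebraMap K D c) =
    IsNonarchimedeanLocalField.valueGroupWithZeroIsoInt K (valuation K c) ^
      Module.finrank K D := by
  rw [divisionValuation_apply, rightNorm_algebraMap, map_pow, map_pow]

variable (D) in
/-- The valuation ring of a division algebra over a local field. -/
def divisionIntegers : Subalgebra 𝒪[K] D where
  __ := (divisionValuation K D).integer
  algebraMap_mem' := fun r => by
    change divisionValuation K D (algebraMap K D r) ≤ 1
    rw [divisionValuation_le_one_iff, rightNorm_algebraMap, map_pow]
    exact pow_le_one₀ zero_le r.2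

variable {K} in
theorem mem_divisionIntegers {x : D} :
    x ∈ divisionIntegers K D ↔ divisionValuation K D x ≤ 1 := Iff.rfl

theorem divisionIntegers_fg : (Subalgebra.toSubmodule (divisionIntegers K D)).FG := by
  let b := Module.finBasis K D
  obtain ⟨γ, hγ⟩ := exists_mem_boundedBy_of_rightNorm_le_one K b
  obtain ⟨t, rfl⟩ := ValuativeRel.valuation_surjective γ
  have hle : Subalgebra.toSubmodule (divisionIntegers K D) ≤
      Submodule.span 𝒪[K] (Set.range fun i => t • b i) := by
    intro x hx
    have hx' := hγ x ((divisionValuation_le_one_iff K).1 hx)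
    rw [← b.sum_equivFun x]
    refine sum_mem fun i _ => ?_
    rcases eq_or_ne t 0 with rfl | ht
    · have := hx' i
      rw [map_zero, le_zero_iff, Valuation.zero_iff] at this
      rw [this, zero_smul]
      exact zero_mem _
    · have hr : b.equivFun x i / t ∈ 𝒪[K] := by
        change valuation K _ ≤ 1
        rw [map_div₀]
        exact div_le_one_of_le₀ (hx' i) zero_le
      have : b.equivFun x i • b i = (⟨_, hr⟩ : 𝒪[K]) • t • b i := by
        change _ = (b.equivFun x i / t) • t • b i
        rw [smul_smul, div_mul_cancel₀ _ ht]
      rw [this]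
      exact Submodule.smul_mem _ _ (Submodule.subset_span ⟨i, rfl⟩)
  have hfg : Module.Finite 𝒪[K] (Submodule.span 𝒪[K] (Set.range fun i => t • b i)) :=
    Module.Finite.span_of_finite _ (Set.finite_range _)
  have : IsNoetherian 𝒪[K] (Submodule.span 𝒪[K] (Set.range fun i => t • b i)) :=
    isNoetherian_of_isNoetherianRing_of_finite _ _
  exact (Module.Finite.iff_fg (R := 𝒪[K])).1
    (Module.Finite.of_injective (Submodule.inclusion hle) (Submodule.inclusion_injective hle))

end DivisionValuation

/-! ### Uniformizers and residue field of a division algebra -/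

section DivisionResidue

open ValuativeRel

variable (K : Type*) [Field K] [ValuativeRel K] [TopologicalSpace K]
  [IsNonarchimedeanLocalField K] (D : Type*) [DivisionRing D] [Algebra K D]
  [FiniteDimensional K D]

/-- The normalized valuation of a local field. -/
abbrev normalizedValuation (c : K) : WithZero (Multiplicative ℤ) :=
  IsNonarchimedeanLocalField.valueGroupWithZeroIsoInt K (valuation K c)

theorem exists_uniformizer : ∃ ϖ : K, normalizedValuation K ϖ = WithZero.exp (-1 : ℤ) := by
  obtain ⟨γ, hγ⟩ := (IsNonarchimedeanLocalField.valueGroupWithZeroIsoInt K).surjective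
    (WithZero.exp (-1 : ℤ))
  obtain ⟨ϖ, rfl⟩ := ValuativeRel.valuation_surjective γ
  exact ⟨ϖ, hγ⟩

theorem normalizedValuation_lt_one_iff {c : K} :
    normalizedValuation K c < 1 ↔ valuation K c < 1 := by
  rw [← map_one (IsNonarchimedeanLocalField.valueGroupWithZeroIsoInt K), map_lt_map_iff]

theorem mem_maximalIdeal_iff {r : 𝒪[K]} :
    r ∈ IsLocalRing.maximalIdeal 𝒪[K] ↔ valuation K (r : K) < 1 := by
  rw [IsLocalRing.mem_maximalIdeal, mem_nonunits_iff,
    (Valuation.integer.integers (valuation K)).isUnit_iff_valuation_eq_one]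
  exact (lt_iff_le_and_ne.trans (and_iff_right r.2)).symm

/-- An element generates the maximal ideal of the valuation ring of `D`. -/
def IsDivisionUniformizer (π : D) : Prop :=
  π ≠ 0 ∧ divisionValuation K D π < 1 ∧
    ∀ x, divisionValuation K D x < 1 → divisionValuation K D x ≤ divisionValuation K D π

variable {K D} in
theorem exists_eq_exp_of_lt_one {x : D} (hx : x ≠ 0) (h : divisionValuation K D x < 1) :
    ∃ n : ℕ, divisionValuation K D x = WithZero.exp (-((n : ℤ) + 1)) := by
  have h0 : divisionValuation K D x ≠ 0 := (Valuation.ne_zero_iff _).2 hx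
  have hlog : WithZero.log (divisionValuation K D x) < 0 := by
    rwa [WithZero.log_lt_iff_lt_exp h0, WithZero.exp_zero]
  refine ⟨(-WithZero.log (divisionValuation K D x) - 1).toNat, ?_⟩
  rw [Int.toNat_of_nonneg (by omega), ← WithZero.exp_log h0, WithZero.log_exp]
  congr 1
  ring

theorem exists_isDivisionUniformizer : ∃ π : D, IsDivisionUniformizer K D π := by
  classical
  have hex : ∃ n : ℕ, ∃ x : D, x ≠ 0 ∧
      divisionValuation K D x = WithZero.exp (-((n : ℤ) + 1)) := by
    obtain ⟨ϖ, hϖ⟩ := exists_uniformizer K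
    have h0 : algebraMap K D ϖ ≠ 0 := by
      rw [Ne, map_eq_zero]
      rintro rfl
      rw [normalizedValuation, map_zero, map_zero] at hϖ
      exact WithZero.exp_ne_zero hϖ.symm
    obtain ⟨n, hn⟩ := exists_eq_exp_of_lt_one (K := K) h0 (by
      rw [divisionValuation_algebraMap]
      refine pow_lt_one₀ zero_le ?_ Module.finrank_pos.ne'
      change normalizedValuation K ϖ < 1
      rw [hϖ, ← WithZero.exp_zero, WithZero.exp_lt_exp]
      norm_num)
    exact ⟨n, _, h0, hn⟩
  obtain ⟨π, hπ0, hπ⟩ := Nat.find_spec hex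
  refine ⟨π, hπ0, ?_, fun x hx => ?_⟩
  · rw [hπ, ← WithZero.exp_zero, WithZero.exp_lt_exp]
    omega
  · rcases eq_or_ne x 0 with rfl | hx0
    · rw [map_zero]
      exact zero_le
    · obtain ⟨n, hn⟩ := exists_eq_exp_of_lt_one hx0 hx
      have := Nat.find_min' hex ⟨x, hx0, hn⟩
      rw [hn, hπ, WithZero.exp_le_exp]
      omega

/-- The maximal ideal of the valuation ring of `D`. -/
def divisionMaximalIdeal : Ideal (divisionIntegers K D) where
  carrier := {x | divisionValuation K D x < 1}
  add_mem' := fun ha hb => (divisionValuation K D).map_add_lt ha hb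
  zero_mem' := by
    change divisionValuation K D 0 < 1
    rw [map_zero]
    exact zero_lt_one
  smul_mem' := fun c x hx => by
    change divisionValuation K D ((c : D) * x) < 1
    rw [map_mul]
    exact (mul_le_of_le_one_left' c.2).trans_lt hx

variable {K D} in
theorem mem_divisionMaximalIdeal {x : divisionIntegers K D} :
    x ∈ divisionMaximalIdeal K D ↔ divisionValuation K D (x : D) < 1 := Iff.rfl

instance : (divisionMaximalIdeal K D).IsTwoSided where
  mul_mem_of_left := fun {a} b ha => by
    rw [mem_divisionMaximalIdeal] at *
    rw [MulMemClass.coe_mul, map_mul]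
    exact (mul_le_of_le_one_right' b.2).trans_lt ha

/-- The residue ring of `D`. -/
def DivisionResidue := divisionIntegers K D ⧸ divisionMaximalIdeal K D

instance : Ring (DivisionResidue K D) :=
  inferInstanceAs (Ring (divisionIntegers K D ⧸ divisionMaximalIdeal K D))

instance : Algebra 𝒪[K] (DivisionResidue K D) :=
  inferInstanceAs (Algebra 𝒪[K] (divisionIntegers K D ⧸ divisionMaximalIdeal K D))

/-- Reduction modulo the maximal ideal. -/
def divisionReduction : divisionIntegers K D →ₐ[𝒪[K]] DivisionResidue K D :=
  Ideal.Quotient.mkₐ 𝒪[K] (divisionMaximalIdeal K D)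

theorem divisionReduction_surjective : Function.Surjective (divisionReduction K D) :=
  Ideal.Quotient.mk_surjective

variable {K D} in
theorem divisionReduction_eq_zero_iff {x : divisionIntegers K D} :
    divisionReduction K D x = 0 ↔ divisionValuation K D (x : D) < 1 :=
  Ideal.Quotient.eq_zero_iff_mem

theorem divisionValuation_algebraMap_lt_one_iff {c : K} :
    divisionValuation K D (algebraMap K D c) < 1 ↔ valuation K c < 1 := by
  rw [divisionValuation_algebraMap, ← normalizedValuation_lt_one_iff]
  exact pow_lt_one_iff_of_nonneg zero_le Module.finrank_pos.ne'

instance : Algebra 𝓀[K] (DivisionResidue K D) :=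
  RingHom.toAlgebra' (Ideal.Quotient.lift (IsLocalRing.maximalIdeal 𝒪[K])
    (algebraMap 𝒪[K] (DivisionResidue K D)) fun r hr => by
      rw [← (divisionReduction K D).commutes, divisionReduction_eq_zero_iff]
      exact (divisionValuation_algebraMap_lt_one_iff K D).2 ((mem_maximalIdeal_iff K).1 hr)) (by
    rintro c x
    obtain ⟨r, rfl⟩ := Ideal.Quotient.mk_surjective c
    exact Algebra.commutes r x)

theorem algebraMap_residue (r : 𝒪[K]) :
    algebraMap 𝓀[K] (DivisionResidue K D) (IsLocalRing.residue 𝒪[K] r) =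
      algebraMap 𝒪[K] (DivisionResidue K D) r := rfl

instance : IsScalarTower 𝒪[K] 𝓀[K] (DivisionResidue K D) := .of_algebraMap_eq fun _ => rfl

instance : Module.Finite 𝒪[K] (divisionIntegers K D) :=
  (Module.Finite.iff_fg (R := 𝒪[K])).2 (divisionIntegers_fg K (D := D))

instance : Module.Finite 𝒪[K] (DivisionResidue K D) :=
  Module.Finite.of_surjective (divisionReduction K D).toLinearMap
    (divisionReduction_surjective K D)

instance : FiniteDimensional 𝓀[K] (DivisionResidue K D) :=
  Module.Finite.of_restrictScalars_finite 𝒪[K] _ _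

instance : Finite (DivisionResidue K D) := Module.finite_of_finite 𝓀[K]

instance : IsDomain (DivisionResidue K D) := by
  have : Nontrivial (DivisionResidue K D) := ⟨1, 0, fun h => by
    rw [← map_one (divisionReduction K D), divisionReduction_eq_zero_iff, OneMemClass.coe_one,
      map_one] at h
    exact lt_irrefl _ h⟩
  have : NoZeroDivisors (DivisionResidue K D) := ⟨fun {a b} hab => by
    obtain ⟨x, rfl⟩ := divisionReduction_surjective K D a
    obtain ⟨y, rfl⟩ := divisionReduction_surjective K D b
    rw [← map_mul, divisionReduction_eq_zero_iff, MulMemClass.coe_mul, map_mul] at hab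
    rw [divisionReduction_eq_zero_iff, divisionReduction_eq_zero_iff]
    by_contra! h
    have hx : divisionValuation K D (x : D) = 1 := le_antisymm x.2 h.1
    have hy : divisionValuation K D (y : D) = 1 := le_antisymm y.2 h.2
    rw [hx, hy, mul_one] at hab
    exact lt_irrefl _ hab⟩
  exact NoZeroDivisors.to_isDomain _

instance : Field (DivisionResidue K D) where
  mul_comm := (Finite.isDomain_to_isField (DivisionResidue K D)).mul_comm
  inv := (Finite.isDomain_to_isField (DivisionResidue K D)).toField.inv
  mul_inv_cancel := (Finite.isDomain_to_isField (DivisionResidue K D)).toField.mul_inv_cancel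
  inv_zero := (Finite.isDomain_to_isField (DivisionResidue K D)).toField.inv_zero
  nnqsmul := _
  nnqsmul_def := fun _ _ => rfl
  qsmul := _
  qsmul_def := fun _ _ => rfl

end DivisionResidue

/-! ### The reduced norm of a uniformizer of a central division algebra -/

section UniformizerNorm

open ValuativeRel

variable {K : Type*} [Field K] [ValuativeRel K] [TopologicalSpace K]
  [IsNonarchimedeanLocalField K] {D : Type*} [DivisionRing D] [Algebra K D]
  [FiniteDimensional K D]

/-- `D` has ramification index `e` over `K`. -/
theorem IsDivisionUniformizer.exists_pow {π : D} (hπ : IsDivisionUniformizer K D π) {ϖ : K}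
    (hϖ : normalizedValuation K ϖ = WithZero.exp (-1 : ℤ)) :
    ∃ e : ℕ, divisionValuation K D (algebraMap K D ϖ) = divisionValuation K D π ^ e := by
  obtain ⟨hπ0, hπ1, hmax⟩ := hπ
  obtain ⟨n, hn⟩ := exists_eq_exp_of_lt_one hπ0 hπ1
  set N := Module.finrank K D
  have hw : divisionValuation K D (algebraMap K D ϖ) = WithZero.exp (-(N : ℤ)) := by
    rw [divisionValuation_algebraMap]
    change normalizedValuation K ϖ ^ N = _
    rw [hϖ, ← WithZero.exp_nsmul]
    congr 1
    simp
  refine ⟨N / (n + 1), ?_⟩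
  have hdiv := Nat.div_add_mod N (n + 1)
  set q := N / (n + 1)
  set r := N % (n + 1)
  have hr : r < n + 1 := Nat.mod_lt _ n.succ_pos
  have hx : divisionValuation K D (algebraMap K D ϖ * (π ^ q)⁻¹) = WithZero.exp (-(r : ℤ)) := by
    rw [map_mul, hw, map_inv₀, map_pow, hn, ← WithZero.exp_nsmul, ← WithZero.exp_neg,
      ← WithZero.exp_add]
    congr 1
    rw [← hdiv]
    push_cast
    simp only [nsmul_eq_mul]
    ring
  have hr0 : r = 0 := by
    by_contra hr0
    have h1 := hmax (algebraMap K D ϖ * (π ^ q)⁻¹) (by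
      rw [hx, ← WithZero.exp_zero, WithZero.exp_lt_exp]; omega)
    rw [hx, hn, WithZero.exp_le_exp] at h1
    omega
  rw [hr0, Nat.cast_zero, neg_zero, WithZero.exp_zero, map_mul, map_inv₀, map_pow] at hx
  exact (mul_inv_eq_one₀ (pow_ne_zero _ ((Valuation.ne_zero_iff _).2 hπ0))).1 hx

theorem normalizedValuation_eq_zpow {ϖ : K}
    (hϖ : normalizedValuation K ϖ = WithZero.exp (-1 : ℤ)) {c : K} (hc : c ≠ 0) :
    ∃ k : ℤ, normalizedValuation K c = normalizedValuation K ϖ ^ k := by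
  have h0 : normalizedValuation K c ≠ 0 := by
    rw [normalizedValuation, Ne, map_eq_zero, Valuation.zero_iff]
    exact hc
  refine ⟨-WithZero.log (normalizedValuation K c), ?_⟩
  rw [hϖ, ← WithZero.exp_zsmul]
  conv_lhs => rw [← WithZero.exp_log h0]
  congr 1
  simp

theorem IsDivisionUniformizer.le_natDegree_minpoly {π : D} (hπ : IsDivisionUniformizer K D π)
    {ϖ : K} (hϖ : normalizedValuation K ϖ = WithZero.exp (-1 : ℤ)) {e : ℕ}
    (he : divisionValuation K D (algebraMap K D ϖ) = divisionValuation K D π ^ e) :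
    e ≤ (minpoly K π).natDegree := by
  by_contra! hlt
  obtain ⟨hπ0, hπ1, -⟩ := hπ
  set w := divisionValuation K D
  set p := minpoly K π
  have hw0 : w π ≠ 0 := (Valuation.ne_zero_iff _).2 hπ0
  let t : ℕ → D := fun i => algebraMap K D (p.coeff i) * π ^ i
  have hsum : ∑ i ∈ Finset.range (p.natDegree + 1), t i = 0 := by
    have := minpoly.aeval K π
    rw [Polynomial.aeval_eq_sum_range] at this
    rw [← this]
    exact Finset.sum_congr rfl fun i _ => (Algebra.smul_def _ _).symm
  have hinj : ∀ i ≤ p.natDegree, ∀ j ≤ p.natDegree, w (t i) = w (t j) → t j ≠ 0 → i = j := by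
    intro i hi j hj hij hj0
    have hw : ∀ i, t i ≠ 0 → ∃ k : ℤ, w (t i) = w π ^ (e * k + i) := fun i hi => by
      have hc : p.coeff i ≠ 0 := fun h => hi (by simp [t, h])
      obtain ⟨k, hk⟩ := normalizedValuation_eq_zpow hϖ hc
      refine ⟨k, ?_⟩
      have hc' : w (algebraMap K D (p.coeff i)) = w (algebraMap K D ϖ) ^ k := by
        rw [divisionValuation_algebraMap, divisionValuation_algebraMap]
        change normalizedValuation K (p.coeff i) ^ _ = (normalizedValuation K ϖ ^ _) ^ _
        rw [hk, ← zpow_natCast, ← zpow_natCast, zpow_comm]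
      rw [map_mul, map_pow, hc', he, zpow_add₀ hw0, zpow_mul, zpow_natCast, zpow_natCast]
    have hi0 : t i ≠ 0 := fun h => by
      rw [h, map_zero] at hij
      exact hj0 ((Valuation.zero_iff _).1 hij.symm)
    obtain ⟨k, hk⟩ := hw i hi0
    obtain ⟨l, hl⟩ := hw j hj0
    rw [hk, hl] at hij
    have h1 := zpow_right_injective₀ (zero_lt_iff.2 hw0) hπ1.ne hij
    have h2 : (e : ℤ) ∣ (i : ℤ) - j := ⟨l - k, by linear_combination h1⟩
    have h3 := Int.eq_zero_of_abs_lt_dvd h2 (by rw [abs_lt]; constructor <;> omega)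
    omega
  obtain ⟨i, hi, hmax⟩ := Finset.exists_max_image (Finset.range (p.natDegree + 1))
    (fun i => w (t i)) ⟨0, by simp⟩
  have hti : t i ≠ 0 := by
    intro h
    have h1 := hmax p.natDegree (by simp)
    have hlead : t p.natDegree = π ^ p.natDegree := by
      have : p.coeff p.natDegree = 1 := minpoly.monic (.of_finite K π)
      simp only [t, this, map_one, one_mul]
    rw [hlead, h, map_zero, le_zero_iff, Valuation.zero_iff] at h1
    exact pow_ne_zero _ hπ0 h1
  rw [← Finset.add_sum_erase _ _ hi, add_eq_zero_iff_eq_neg] at hsum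
  have hlt' : w (∑ j ∈ (Finset.range (p.natDegree + 1)).erase i, t j) < w (t i) := by
    refine w.map_sum_lt ((Valuation.ne_zero_iff _).2 hti) fun j hj => ?_
    obtain ⟨hji, hj⟩ := Finset.mem_erase.1 hj
    refine lt_of_le_of_ne (hmax j hj) fun h => hji (hinj j ?_ i ?_ h hti)
    · exact Nat.lt_succ_iff.1 (Finset.mem_range.1 hj)
    · exact Nat.lt_succ_iff.1 (Finset.mem_range.1 hi)
  conv_rhs at hlt' => rw [hsum, Valuation.map_neg]
  exact lt_irrefl _ hlt'

/-- A generator of the residue field, up to lifting: polynomials in `a` of degree less than the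
degree of `a` represent all residue classes. -/
theorem exists_residue_generator (K : Type*) [Field K] [ValuativeRel K] [TopologicalSpace K]
    [IsNonarchimedeanLocalField K] (D : Type*) [DivisionRing D] [Algebra K D]
    [FiniteDimensional K D] : ∃ a : divisionIntegers K D, ∀ x : divisionIntegers K D,
      ∃ g : ℕ → 𝒪[K], divisionValuation K D ((x : D) -
        ∑ j ∈ Finset.range (minpoly K (a : D)).natDegree, (g j : K) • (a : D) ^ j) < 1 := by
  obtain ⟨u, hu⟩ := IsCyclic.exists_generator (α := (DivisionResidue K D)ˣ)
  obtain ⟨a, ha⟩ := divisionReduction_surjective K D u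
  refine ⟨a, fun x => ?_⟩
  set p := minpoly K (a : D)
  set α := divisionReduction K D a
  have hmonic : p.Monic := minpoly.monic (.of_finite K _)
  obtain ⟨s, hs0, hs, i₀, hi₀⟩ := exists_primitive_multiple
    (c := fun i : Fin (p.natDegree + 1) => p.coeff i) (fun h => by
      have := congrFun h (Fin.last _)
      rw [Fin.val_last, hmonic.coeff_natDegree] at this
      exact one_ne_zero this)
  let q : Polynomial 𝓀[K] := ∑ i : Fin (p.natDegree + 1),
    Polynomial.monomial i (IsLocalRing.residue 𝒪[K] ⟨s * p.coeff i, hs i⟩)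
  have hq0 : q ≠ 0 := by
    intro h
    have h1 := congrArg (fun q => Polynomial.coeff q i₀) h
    simp only [q, Polynomial.finsetSum_coeff, Polynomial.coeff_monomial, Polynomial.coeff_zero]
      at h1
    rw [Finset.sum_eq_single i₀ (fun j _ hj => if_neg fun h => hj (Fin.ext h))
      (fun h => absurd (Finset.mem_univ _) h), if_pos rfl] at h1
    have h2 : (⟨s * p.coeff i₀, hs i₀⟩ : 𝒪[K]) = 1 := Subtype.ext hi₀
    rw [h2, map_one] at h1
    exact one_ne_zero h1
  have hqdeg : q.natDegree ≤ p.natDegree :=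
    Polynomial.natDegree_sum_le_of_forall_le _ _ fun i _ =>
      (Polynomial.natDegree_monomial_le _).trans (Nat.lt_succ_iff.1 i.2)
  have hqα : Polynomial.aeval α q = 0 := by
    have h1 : ∑ i : Fin (p.natDegree + 1), (⟨s * p.coeff i, hs i⟩ : 𝒪[K]) • a ^ (i : ℕ) = 0 := by
      apply Subtype.ext
      have := minpoly.aeval K (a : D)
      rw [Polynomial.aeval_eq_sum_range, ← Fin.sum_univ_eq_sum_range
        (fun i => p.coeff i • (a : D) ^ i)] at this
      have h2 := congrArg (fun z => s • z) this
      simp only [Finset.smul_sum, smul_smul, smul_zero] at h2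
      rw [AddSubmonoidClass.coe_finsetSum]
      exact h2
    have h2 := congrArg (divisionReduction K D) h1
    simp only [map_sum, map_zero, map_smul, map_pow] at h2
    simp only [q, map_sum, Polynomial.aeval_monomial, algebraMap_residue]
    rw [← h2]
    exact Finset.sum_congr rfl fun i _ => (Algebra.smul_def _ _).symm
  obtain ⟨h, hh⟩ : ∃ h : Polynomial 𝓀[K], Polynomial.aeval α h = divisionReduction K D x := by
    rcases eq_or_ne (divisionReduction K D x) 0 with h0 | h0
    · exact ⟨0, by rw [map_zero, h0]⟩
    · obtain ⟨k, hk⟩ := (mem_powers_iff_mem_zpowers).2 (hu (Units.mk0 _ h0))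
      refine ⟨Polynomial.X ^ k, ?_⟩
      have := congrArg Units.val hk
      rw [map_pow, Polynomial.aeval_X]
      simpa [ha] using this
  have hmod : Polynomial.aeval α (h % q) = divisionReduction K D x := by
    conv_rhs => rw [← hh, ← EuclideanDomain.mod_add_div h q, map_add, map_mul, hqα, zero_mul,
      add_zero]
  have hdeg : (h % q).natDegree < p.natDegree := by
    rcases eq_or_ne (h % q) 0 with h0 | h0
    · rw [h0, Polynomial.natDegree_zero]
      exact minpoly.natDegree_pos (.of_finite K _)
    · rw [Polynomial.natDegree_lt_iff_degree_lt h0]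
      exact (EuclideanDomain.mod_lt h hq0).trans_le
        (Polynomial.degree_le_natDegree.trans (by exact_mod_cast hqdeg))
  choose g hg using fun j => IsLocalRing.residue_surjective ((h % q).coeff j)
  refine ⟨g, ?_⟩
  have hx : divisionReduction K D
      (x - ∑ j ∈ Finset.range p.natDegree, g j • a ^ j) = 0 := by
    rw [map_sub, ← hmod, sub_eq_zero, map_sum]
    have hcoeff := (h % q).as_sum_range_C_mul_X_pow' (n := p.natDegree) hdeg
    conv_lhs => rw [hcoeff, map_sum]
    refine Finset.sum_congr rfl fun j _ => ?_
    rw [map_mul, map_pow, Polynomial.aeval_X, Polynomial.aeval_C, ← hg, map_smul, map_pow,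
      Algebra.smul_def]
    rfl
  rw [divisionReduction_eq_zero_iff] at hx
  convert hx using 2
  simp
  rfl

theorem exists_eq_smul_of_valuation_le {ϖ : K} (hϖ0 : ϖ ≠ 0) {x : D}
    (hx : divisionValuation K D x ≤ divisionValuation K D (algebraMap K D ϖ)) :
    ∃ y ∈ divisionIntegers K D, x = ϖ • y := by
  refine ⟨ϖ⁻¹ • x, ?_, (smul_inv_smul₀ hϖ0 x).symm⟩
  rw [mem_divisionIntegers, Algebra.smul_def, map_mul, map_inv₀ (algebraMap K D), map_inv₀]
  exact inv_mul_le_one_of_le₀ hx zero_le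

theorem exists_smul_mem_divisionIntegers {ϖ : K}
    (hϖ : normalizedValuation K ϖ = WithZero.exp (-1 : ℤ)) (x : D) :
    ∃ k : ℕ, ϖ ^ k • x ∈ divisionIntegers K D := by
  rcases eq_or_ne x 0 with rfl | hx
  · exact ⟨0, by rw [smul_zero]; exact zero_mem _⟩
  have h0 : divisionValuation K D x ≠ 0 := (Valuation.ne_zero_iff _).2 hx
  refine ⟨(WithZero.log (divisionValuation K D x)).toNat, ?_⟩
  rw [mem_divisionIntegers, Algebra.smul_def, map_mul, map_pow, map_pow,
    divisionValuation_algebraMap]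
  change (normalizedValuation K ϖ ^ _) ^ _ * _ ≤ 1
  have hN : 1 ≤ (Module.finrank K D : ℤ) := by exact_mod_cast Module.finrank_pos
  rw [hϖ, ← WithZero.exp_nsmul, ← WithZero.exp_nsmul, ← WithZero.exp_log h0, WithZero.log_exp,
    ← WithZero.exp_add, ← WithZero.exp_zero, WithZero.exp_le_exp]
  simp only [nsmul_eq_mul]
  nlinarith [Int.self_le_toNat (WithZero.log (divisionValuation K D x)),
    Int.natCast_nonneg (WithZero.log (divisionValuation K D x)).toNat]

theorem span_divisionIntegers :
    Submodule.span K (divisionIntegers K D : Set D) = ⊤ := by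
  obtain ⟨ϖ, hϖ⟩ := exists_uniformizer K
  have hϖ0 : ϖ ≠ 0 := by
    rintro rfl
    rw [normalizedValuation, map_zero, map_zero] at hϖ
    exact WithZero.exp_ne_zero hϖ.symm
  refine eq_top_iff.2 fun x _ => ?_
  obtain ⟨k, hk⟩ := exists_smul_mem_divisionIntegers hϖ x
  rw [← inv_smul_smul₀ (pow_ne_zero k hϖ0) x]
  exact Submodule.smul_mem _ _ (Submodule.subset_span hk)

theorem IsDivisionUniformizer.finrank_le {π : D} (hπ : IsDivisionUniformizer K D π) {ϖ : K}
    (hϖ : normalizedValuation K ϖ = WithZero.exp (-1 : ℤ)) {e d : ℕ}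
    (he : divisionValuation K D (algebraMap K D ϖ) = divisionValuation K D π ^ e)
    (hd : ∀ a : D, (minpoly K a).natDegree ≤ d) : Module.finrank K D ≤ d * e := by
  obtain ⟨hπ0, hπ1, hmax⟩ := hπ
  have hw0 : 0 < divisionValuation K D π := zero_lt_iff.2 ((Valuation.ne_zero_iff _).2 hπ0)
  have hϖ0 : ϖ ≠ 0 := by
    rintro rfl
    rw [normalizedValuation, map_zero, map_zero] at hϖ
    exact WithZero.exp_ne_zero hϖ.symm
  have hϖ1 : valuation K ϖ < 1 := by
    rw [← normalizedValuation_lt_one_iff, hϖ, ← WithZero.exp_zero, WithZero.exp_lt_exp]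
    norm_num
  obtain ⟨a, ha⟩ := exists_residue_generator K D
  let M := Subalgebra.toSubmodule (divisionIntegers K D)
  let f : Fin d × Fin e → D := fun p => (a : D) ^ (p.1 : ℕ) * π ^ (p.2 : ℕ)
  let N := Submodule.span 𝒪[K] (Set.range f)
  let ϖ' : 𝒪[K] := ⟨ϖ, hϖ1.le⟩
  have hstep : ∀ i ≤ e, ∀ x : D, divisionValuation K D x ≤ divisionValuation K D π ^ (e - i) →
      x ∈ N ⊔ IsLocalRing.maximalIdeal 𝒪[K] • M := by
    intro i
    induction i with
    | zero =>
      intro _ x hx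
      rw [Nat.sub_zero, ← he] at hx
      obtain ⟨y, hy, rfl⟩ := exists_eq_smul_of_valuation_le hϖ0 hx
      refine Submodule.mem_sup_right ?_
      exact Submodule.smul_mem_smul (r := ϖ') ((mem_maximalIdeal_iff K).2 hϖ1) hy
    | succ i ih =>
      intro hi x hx
      have hi' : e - i = (e - (i + 1)) + 1 := by omega
      set l := e - (i + 1)
      have hy : x * (π ^ l)⁻¹ ∈ divisionIntegers K D := by
        rw [mem_divisionIntegers, map_mul, map_inv₀, map_pow]
        exact mul_inv_le_one_of_le₀ hx zero_le
      obtain ⟨g, hg⟩ := ha ⟨_, hy⟩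
      set G := ∑ j ∈ Finset.range (minpoly K (a : D)).natDegree, (g j : K) • (a : D) ^ j
      have hx' : x = G * π ^ l + (x * (π ^ l)⁻¹ - G) * π ^ l := by
        rw [← add_mul, add_sub_cancel, inv_mul_cancel_right₀ (pow_ne_zero _ hπ0)]
      rw [hx']
      refine add_mem (Submodule.mem_sup_left ?_) (ih (by omega) _ ?_)
      · rw [Finset.sum_mul]
        refine sum_mem fun j hj => ?_
        have hjd : j < d := (Finset.mem_range.1 hj).trans_le (hd _)
        rw [smul_mul_assoc]
        exact Submodule.smul_mem N (g j)
          (Submodule.subset_span ⟨(⟨j, hjd⟩, ⟨l, by omega⟩), rfl⟩)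
      · rw [map_mul, map_pow, hi', pow_succ, mul_comm]
        exact mul_le_mul_right (hmax _ hg) _
  have hle : M ≤ N := by
    refine Submodule.le_of_le_smul_of_le_jacobson_bot (divisionIntegers_fg K)
      (I := IsLocalRing.maximalIdeal 𝒪[K]) (IsLocalRing.maximalIdeal_le_jacobson _) fun x hx => ?_
    refine hstep e le_rfl x ?_
    rw [Nat.sub_self, pow_zero]
    exact hx
  have htop : Submodule.span K (Set.range f) = ⊤ := by
    rw [eq_top_iff, ← span_divisionIntegers, Submodule.span_le]
    exact fun x hx => Submodule.span_le_restrictScalars 𝒪[K] K _ (hle hx)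
  have h := finrank_range_le_card (R := K) f
  rw [Set.finrank, htop, finrank_top, Fintype.card_prod, Fintype.card_fin, Fintype.card_fin] at h
  exact h

theorem IsDivisionUniformizer.exists_isReducedNorm [Algebra.IsCentral K D] {π : D}
    (hπ : IsDivisionUniformizer K D π) :
    ∃ ν : K, IsReducedNorm K π ν ∧ normalizedValuation K ν = WithZero.exp (-1 : ℤ) := by
  obtain ⟨ϖ, hϖ⟩ := exists_uniformizer K
  obtain ⟨e, he⟩ := hπ.exists_pow hϖ
  obtain ⟨d, hd, ⟨φ⟩⟩ := exists_splitting K D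
  have hed := hπ.le_natDegree_minpoly hϖ he
  have hmin := natDegree_minpoly_le_of_splitting _ φ
  have hfin := hπ.finrank_le hϖ he hmin
  have hN : 0 < Module.finrank K D := Module.finrank_pos
  have hd0 : 0 < d := by
    rcases Nat.eq_zero_or_pos d with rfl | h
    · omega
    · exact h
  have hde : d ≤ e := by
    rw [← hd] at hfin
    exact Nat.le_of_mul_le_mul_left hfin hd0
  obtain rfl : d = e := le_antisymm hde (hed.trans (hmin π))
  obtain ⟨ν, hν⟩ := det_splitting_of_natDegree_minpoly _ φ π hed
  have hνr : IsReducedNorm K π ν := ⟨d, φ, hν⟩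
  refine ⟨ν, hνr, ?_⟩
  have h1 := hνr.pow_eq
  rw [← hd, Nat.sqrt_eq] at h1
  have h2 : normalizedValuation K ν ^ d = divisionValuation K D π := by
    rw [divisionValuation_apply, ← h1, map_pow, map_pow]
  rw [divisionValuation_algebraMap, ← h2] at he
  change normalizedValuation K ϖ ^ _ = _ at he
  rw [← pow_mul, ← hd, hϖ] at he
  exact ((pow_left_inj₀ zero_le zero_le (Nat.mul_pos hd0 hd0).ne').1 he).symm

end UniformizerNorm

/-! ### Maximal orders are conjugate to matrix rings -/

section Lattices

variable {K : Type*} [Field K] [ValuativeRel K] [TopologicalSpace K]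
  [IsNonarchimedeanLocalField K] {D : Type*} [DivisionRing D] [Algebra K D]
  [FiniteDimensional K D]

open Matrix

/-- A finitely generated module over the valuation ring of `D` inside a vector space over `D` is
generated by linearly independent vectors. -/
theorem exists_linearIndependent_span_eq {V : Type*} [AddCommGroup V] [Module D V]
    (L : Submodule (divisionIntegers K D) V) (hL : L.FG) :
    ∃ (N : ℕ) (g : Fin N → V), LinearIndependent D g ∧
      Submodule.span (divisionIntegers K D) (Set.range g) = L := by
  classical
  have hex : ∃ (N : ℕ) (g : Fin N → V),
      Submodule.span (divisionIntegers K D) (Set.range g) = L := by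
    obtain ⟨N, g, hg⟩ := Submodule.fg_iff_exists_fin_generating_family.1 hL
    exact ⟨N, g, hg⟩
  obtain ⟨g, hg⟩ := Nat.find_spec hex
  refine ⟨_, g, ?_, hg⟩
  have hmin := fun N => Nat.find_min (H := hex) (m := N)
  generalize Nat.find hex = N at g hg hmin
  by_contra hdep
  obtain ⟨c, hc, j, hj⟩ := Fintype.not_linearIndependent_iff.1 hdep
  have : Nonempty (Fin N) := ⟨j⟩
  obtain ⟨i, hi⟩ := Finite.exists_max fun i => divisionValuation K D (c i)
  have hi0 : c i ≠ 0 := fun h => by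
    have := hi j
    rw [h, map_zero, le_zero_iff, Valuation.zero_iff] at this
    exact hj this
  obtain ⟨N, rfl⟩ : ∃ M, N = M + 1 := ⟨N - 1, by have := i.2; omega⟩
  refine hmin N N.lt_succ_self ⟨fun k => g (i.succAbove k), ?_⟩
  rw [← hg]
  refine le_antisymm (Submodule.span_mono ?_) (Submodule.span_le.2 ?_)
  · rintro _ ⟨k, rfl⟩
    exact ⟨_, rfl⟩
  · rintro _ ⟨k, rfl⟩
    rcases eq_or_ne k i with rfl | hk
    · have hsum : g k = ∑ l, (-((c k)⁻¹ * c (k.succAbove l))) • g (k.succAbove l) := by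
        rw [Fin.sum_univ_succAbove _ k, add_eq_zero_iff_eq_neg] at hc
        rw [← inv_smul_smul₀ hi0 (g k), hc, smul_neg, Finset.smul_sum, ← Finset.sum_neg_distrib]
        simp only [smul_smul, neg_smul]
      rw [hsum]
      refine sum_mem fun l _ => ?_
      have hl : -((c k)⁻¹ * c (k.succAbove l)) ∈ divisionIntegers K D := by
        rw [mem_divisionIntegers, Valuation.map_neg, map_mul, map_inv₀]
        exact inv_mul_le_one_of_le₀ (hi _) zero_le
      exact Submodule.smul_mem _ (⟨_, hl⟩ : divisionIntegers K D) (Submodule.subset_span ⟨l, rfl⟩)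
    · obtain ⟨l, rfl⟩ := Fin.exists_succAbove_eq hk
      exact Submodule.subset_span ⟨l, rfl⟩

/-- A full lattice of row vectors consists of the integral combinations of the rows of an
invertible matrix. -/
theorem exists_unit_mem_iff_vecMul {m : ℕ} (L : Submodule (divisionIntegers K D) (Fin m → D))
    (hL : L.FG) (hspan : Submodule.span D (L : Set (Fin m → D)) = ⊤) :
    ∃ G : (Matrix (Fin m) (Fin m) D)ˣ, (∀ i, G.val i ∈ L) ∧
      ∀ x ∈ L, ∀ i, (x ᵥ* G.inv) i ∈ divisionIntegers K D := by
  obtain ⟨N, g, hli, hg⟩ := exists_linearIndependent_span_eq L hL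
  have htop : ⊤ ≤ Submodule.span D (Set.range g) := by
    rw [← hspan, Submodule.span_le, ← hg]
    exact Submodule.span_le_restrictScalars (divisionIntegers K D) D (Set.range g)
  let b := Module.Basis.mk hli htop
  have hN : N = m := by
    have := Module.finrank_eq_card_basis b
    rw [Fintype.card_fin, Module.finrank_fin_fun] at this
    exact this.symm
  subst hN
  let G : Matrix (Fin N) (Fin N) D := Matrix.of g
  let H : Matrix (Fin N) (Fin N) D := Matrix.of fun i => b.equivFun (Pi.single i 1)
  have hvec : ∀ c : Fin N → D, c ᵥ* G = ∑ i, c i • g i := fun c => by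
    ext j
    simp [vecMul, dotProduct, G]
  have hHG : H * G = 1 := by
    ext i j
    have h1 : (H * G) i = H i ᵥ* G := rfl
    have h2 : H i ᵥ* G = Pi.single i 1 := by
      rw [hvec]
      conv_rhs => rw [← b.sum_equivFun (Pi.single i 1)]
      exact Finset.sum_congr rfl fun k _ => by rw [Module.Basis.mk_apply]; rfl
    rw [h1, h2, Matrix.one_apply, Pi.single_apply]
    simp only [eq_comm]
  have hGH : G * H = 1 := mul_eq_one_symm hHG
  refine ⟨⟨G, H, hGH, hHG⟩, fun i => ?_, fun x hx => ?_⟩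
  · rw [← hg]
    exact Submodule.subset_span ⟨i, rfl⟩
  · rw [← hg] at hx
    change ∀ i, (x ᵥ* H) i ∈ divisionIntegers K D
    induction hx using Submodule.span_induction with
    | mem x hx =>
      obtain ⟨k, rfl⟩ := hx
      intro i
      have : g k ᵥ* H = (G * H) k := rfl
      rw [this, hGH, Matrix.one_apply]
      split_ifs
      · exact one_mem _
      · exact zero_mem _
    | zero => intro i; rw [zero_vecMul]; exact zero_mem _
    | add x y _ _ hx hy =>
      intro i
      rw [add_vecMul]
      exact add_mem (hx i) (hy i)
    | smul a x _ hx =>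
      intro i
      have : (a • x) ᵥ* H = (a : D) • (x ᵥ* H) := smul_vecMul (a : D) x H
      rw [this]
      exact mul_mem a.2 (hx i)

/-- Conjugation by a unit. -/
def conjAlgEquiv {A : Type*} [Ring A] [Algebra K A] (G : Aˣ) : A ≃ₐ[K] A where
  toFun x := G.val * x * G.inv
  invFun x := G.inv * x * G.val
  left_inv x := by simp [mul_assoc]
  right_inv x := by simp [mul_assoc]
  map_mul' x y := by simp [mul_assoc]
  map_add' x y := by rw [mul_add, add_mul]
  commutes' r := by rw [mul_assoc, Algebra.commutes, ← mul_assoc, G.val_inv, one_mul]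

variable {B : Type*} [Ring B] [Algebra K B]

/-- The order of all elements that correspond to integral matrices. -/
def matrixOrder {m : ℕ} (e : B ≃ₐ[K] Matrix (Fin m) (Fin m) D) : Subalgebra 𝒪[K] B where
  carrier := {b | ∀ i j, e b i j ∈ divisionIntegers K D}
  mul_mem' := fun {a b} ha hb i j => by
    rw [map_mul, Matrix.mul_apply]
    exact sum_mem fun k _ => mul_mem (ha i k) (hb k j)
  add_mem' := fun {a b} ha hb i j => by
    rw [map_add]
    exact add_mem (ha i j) (hb i j)
  algebraMap_mem' := fun r i j => by
    have : e (algebraMap 𝒪[K] B r) = algebraMap K _ (r : K) := e.commutes _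
    rw [this, Matrix.algebraMap_matrix_apply]
    split_ifs
    · exact (divisionIntegers K D).algebraMap_mem r
    · exact zero_mem _

theorem matrixOrder_fg {m : ℕ} (e : B ≃ₐ[K] Matrix (Fin m) (Fin m) D) :
    (Subalgebra.toSubmodule (matrixOrder e)).FG := by
  let f : Matrix (Fin m) (Fin m) (divisionIntegers K D) →ₗ[𝒪[K]] matrixOrder e :=
    { toFun := fun M => ⟨e.symm (M.map (↑)), fun i j => by
        rw [AlgEquiv.apply_symm_apply]
        exact (M i j).2⟩
      map_add' := fun M M' => Subtype.ext <| by
        change e.symm _ = e.symm _ + e.symm _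
        rw [← map_add]
        rfl
      map_smul' := fun r M => Subtype.ext <| by
        change e.symm _ = (r : K) • e.symm _
        rw [← map_smul]
        rfl }
  have hf : Function.Surjective f := fun b =>
    ⟨Matrix.of fun i j => ⟨e b i j, b.2 i j⟩, Subtype.ext (e.symm_apply_apply b)⟩
  exact (Module.Finite.iff_fg (R := 𝒪[K])).1 (Module.Finite.of_surjective f hf)

theorem IsMaximalOrder.exists_eq_matrixOrder {O : Subalgebra 𝒪[K] B} (hO : IsMaximalOrder K O)
    {m : ℕ} (e₀ : B ≃ₐ[K] Matrix (Fin m) (Fin m) D) :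
    ∃ e : B ≃ₐ[K] Matrix (Fin m) (Fin m) D, O = matrixOrder e := by
  obtain ⟨s, hs⟩ := hO.1.fg
  let L : Submodule (divisionIntegers K D) (Fin m → D) :=
    Submodule.span _ {x | ∃ o ∈ O, ∃ i, x = e₀ o i}
  have hLfg : L.FG := by
    have hfin : (Set.range fun p : s × Fin m => e₀ p.1 p.2).Finite := Set.finite_range _
    have hL : L = Submodule.span _ (Set.range fun p : s × Fin m => e₀ p.1 p.2) := by
      refine le_antisymm (Submodule.span_le.2 ?_) (Submodule.span_mono ?_)
      · rintro _ ⟨o, ho, i, rfl⟩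
        have ho' : o ∈ Submodule.span 𝒪[K] (s : Set B) := hs ▸ ho
        clear ho
        induction ho' using Submodule.span_induction with
        | mem x hx => exact Submodule.subset_span ⟨(⟨x, hx⟩, i), rfl⟩
        | zero => rw [map_zero]; exact zero_mem _
        | add x y _ _ hx hy => rw [map_add]; exact add_mem hx hy
        | smul r x _ hx =>
          have : e₀ (r • x) i = algebraMap 𝒪[K] (divisionIntegers K D) r • e₀ x i := by
            have h1 : e₀ (r • x) = (r : K) • e₀ x := map_smul e₀ (r : K) x
            rw [h1]
            ext j
            exact Algebra.smul_def (r : K) _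
          rw [this]
          exact Submodule.smul_mem _ _ hx
      · rintro _ ⟨⟨x, i⟩, rfl⟩
        have hx : (x : B) ∈ Subalgebra.toSubmodule O := hs ▸ Submodule.subset_span x.2
        exact ⟨x, hx, i, rfl⟩
    rw [hL]
    exact Submodule.fg_span hfin
  have hLtop : Submodule.span D (L : Set (Fin m → D)) = ⊤ := by
    rw [eq_top_iff, ← (Pi.basisFun D (Fin m)).span_eq, Submodule.span_le]
    rintro _ ⟨i, rfl⟩
    refine Submodule.subset_span (Submodule.subset_span ⟨1, one_mem O, i, ?_⟩)
    ext j
    rw [map_one, Pi.basisFun_apply, Matrix.one_apply, Pi.single_apply]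
    simp only [eq_comm]
  have hLmul : ∀ o ∈ O, ∀ x ∈ L, x ᵥ* e₀ o ∈ L := by
    intro o ho x hx
    induction hx using Submodule.span_induction with
    | mem x hx =>
      obtain ⟨o', ho', i, rfl⟩ := hx
      refine Submodule.subset_span ⟨o' * o, mul_mem ho' ho, i, ?_⟩
      rw [map_mul]
      rfl
    | zero => rw [zero_vecMul]; exact zero_mem _
    | add x y _ _ hx hy => rw [add_vecMul]; exact add_mem hx hy
    | smul a x _ hx =>
      have : (a • x) ᵥ* e₀ o = a • (x ᵥ* e₀ o) := smul_vecMul (a : D) x _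
      rw [this]
      exact Submodule.smul_mem _ _ hx
  obtain ⟨G, hG, hGL⟩ := exists_unit_mem_iff_vecMul L hLfg hLtop
  let e := e₀.trans (conjAlgEquiv G)
  have hle : O ≤ matrixOrder e := fun o ho i j => by
    have h1 : e o i = (G.val i ᵥ* e₀ o) ᵥ* G.inv := rfl
    rw [h1]
    exact hGL _ (hLmul o ho _ (hG i)) j
  refine ⟨e, le_antisymm hle (hO.2 ?_ hle)⟩
  have : (Subalgebra.toSubmodule O).IsLattice K := hO.1
  exact Submodule.IsLattice.of_le_of_isLattice_of_fg K
    (M := Subalgebra.toSubmodule O) hle (matrixOrder_fg e)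

end Lattices

/-! ### Reduction modulo the Jacobson radical -/

section Reduction

variable {S : Type*} [Ring S]

theorem isUnit_of_sub_one_mem_jacobson {x : S} (hx : x - 1 ∈ Ring.jacobson S) : IsUnit x := by
  have key : ∀ x : S, x - 1 ∈ Ring.jacobson S → ∃ s, s * x = 1 ∧ s - 1 ∈ Ring.jacobson S := by
    intro x hx
    obtain ⟨s, hs⟩ := Ideal.exists_mul_sub_mem_of_sub_one_mem_jacobson (I := ⊥) x
      (by rwa [Ideal.jacobson_bot])
    rw [Ideal.mem_bot, sub_eq_zero] at hs
    refine ⟨s, hs, ?_⟩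
    have : s - 1 = -(s * (x - 1)) := by rw [mul_sub, hs, mul_one, neg_sub]
    rw [this]
    exact neg_mem (Ideal.mul_mem_left _ _ hx)
  obtain ⟨s, hs, hs1⟩ := key x hx
  obtain ⟨t, ht, -⟩ := key s hs1
  have htx : t = x := by rw [← mul_one t, ← hs, ← mul_assoc, ht, one_mul]
  exact ⟨⟨x, s, htx ▸ ht, hs⟩, rfl⟩

variable {m : ℕ} {F : Type*} [Field F] {ρ : S →+* Matrix (Fin m) (Fin m) F}

theorem IsReduction.isUnit_of_isUnit_map (hρ : IsReduction ρ) {x : S} (hx : IsUnit (ρ x)) :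
    IsUnit x := by
  obtain ⟨u, hu⟩ := hx
  obtain ⟨y, hy⟩ := hρ.1 u.inv
  have h : ∀ z : S, ρ z = 1 → IsUnit z := fun z hz => by
    refine isUnit_of_sub_one_mem_jacobson ?_
    rw [← hρ.2, RingHom.mem_ker, map_sub, map_one, hz, sub_self]
  have h1 := h (x * y) (by rw [map_mul, ← hu, hy]; exact u.val_inv)
  have h2 := h (y * x) (by rw [map_mul, ← hu, hy]; exact u.inv_val)
  obtain ⟨a, ha⟩ := h1.exists_right_inv
  obtain ⟨b, hb⟩ := h2.exists_left_inv
  rw [mul_assoc] at ha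
  rw [← mul_assoc] at hb
  exact ⟨⟨x, y * a, ha, by rw [← left_inv_eq_right_inv hb ha, hb]⟩, rfl⟩

theorem IsReduction.comap_map (hρ : IsReduction ρ) {P : Ideal S} (hP : P.IsMaximal) :
    Ideal.comap ρ (Ideal.map ρ P) = P := by
  rw [Ideal.comap_map_of_surjective ρ hρ.1, sup_eq_left]
  exact (hρ.2.le).trans (Ring.jacobson_le_of_isMaximal P)

theorem IsReduction.isMaximal_map (hρ : IsReduction ρ) {P : Ideal S} (hP : P.IsMaximal) :
    (Ideal.map ρ P).IsMaximal := by
  refine (Ideal.map_eq_top_or_isMaximal_of_surjective ρ hρ.1 hP).resolve_left fun h => ?_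
  have := hρ.comap_map hP
  rw [h, Ideal.comap_top] at this
  exact hP.ne_top this.symm

end Reduction

/-! ### The reduction of a maximal order -/

section OrderReduction

variable {K : Type*} [Field K] [ValuativeRel K] [TopologicalSpace K]
  [IsNonarchimedeanLocalField K] {D : Type*} [DivisionRing D] [Algebra K D]
  [FiniteDimensional K D] {B : Type*} [Ring B] [Algebra K B] {m : ℕ}
  (e : B ≃ₐ[K] Matrix (Fin m) (Fin m) D)

open Matrix

/-- The integral matrix of an element of the order. -/
def toIntegralMatrix : matrixOrder e →+* Matrix (Fin m) (Fin m) (divisionIntegers K D) where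
  toFun b := Matrix.of fun i j => ⟨e b i j, b.2 i j⟩
  map_one' := by
    ext i j
    change e 1 i j = _
    rw [map_one, Matrix.one_apply, Matrix.one_apply]
    split_ifs <;> rfl
  map_mul' a b := by
    ext i j
    change e (a * b) i j = _
    rw [map_mul, Matrix.mul_apply, Matrix.mul_apply, AddSubmonoidClass.coe_finsetSum]
    rfl
  map_zero' := by
    ext i j
    change e 0 i j = _
    rw [map_zero]
    rfl
  map_add' a b := by
    ext i j
    change e (a + b) i j = _
    rw [map_add]
    rfl

/-- Reduction of the matrix entries modulo the maximal ideal of `D`. -/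
def orderReduction : matrixOrder e →+* Matrix (Fin m) (Fin m) (DivisionResidue K D) :=
  (divisionReduction K D : divisionIntegers K D →+* DivisionResidue K D).mapMatrix.comp
    (toIntegralMatrix e)

theorem orderReduction_apply (b : matrixOrder e) (i j : Fin m) :
    orderReduction e b i j = divisionReduction K D ⟨e b i j, b.2 i j⟩ := rfl

theorem orderReduction_apply_eq_zero_iff {b : matrixOrder e} {i j : Fin m} :
    orderReduction e b i j = 0 ↔ divisionValuation K D (e b i j) < 1 := by
  rw [orderReduction_apply, divisionReduction_eq_zero_iff]

theorem orderReduction_surjective : Function.Surjective (orderReduction e) := by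
  intro M
  choose N hN using fun i j => divisionReduction_surjective K D (M i j)
  refine ⟨⟨e.symm (Matrix.of fun i j => (N i j : D)), fun i j => ?_⟩, ?_⟩
  · rw [AlgEquiv.apply_symm_apply]
    exact (N i j).2
  · ext i j
    rw [orderReduction_apply, ← hN]
    congr 1
    apply Subtype.ext
    change e (e.symm _) i j = _
    rw [AlgEquiv.apply_symm_apply]
    rfl

theorem orderReduction_algebraMap (r : 𝒪[K]) :
    orderReduction e (algebraMap 𝒪[K] (matrixOrder e) r) =
      algebraMap 𝓀[K] (Matrix (Fin m) (Fin m) (DivisionResidue K D))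
        (IsLocalRing.residue 𝒪[K] r) := by
  ext i j
  rw [orderReduction_apply, Matrix.algebraMap_matrix_apply, algebraMap_residue,
    ← (divisionReduction K D).commutes, ← map_zero (divisionReduction K D), ← apply_ite]
  congr 1
  apply Subtype.ext
  have : e (algebraMap K B (r : K)) = algebraMap K _ (r : K) := e.commutes _
  change e (algebraMap K B (r : K)) i j = _
  rw [this, Matrix.algebraMap_matrix_apply]
  split_ifs <;> rfl

instance : Module.Finite 𝒪[K] (matrixOrder e) :=
  (Module.Finite.iff_fg (R := 𝒪[K])).2 (matrixOrder_fg e)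

theorem exists_pow_eq_smul {x : matrixOrder e} (hx : orderReduction e x = 0) :
    ∃ k : ℕ, ∃ r ∈ IsLocalRing.maximalIdeal 𝒪[K], ∃ y : matrixOrder e, x ^ k = r • y := by
  obtain ⟨ϖ, hϖ⟩ := exists_uniformizer K
  obtain ⟨π, hπ⟩ := exists_isDivisionUniformizer K D
  obtain ⟨n, hn⟩ := hπ.exists_pow hϖ
  obtain ⟨-, hπ1, hmax⟩ := hπ
  have hϖ0 : ϖ ≠ 0 := by
    rintro rfl
    rw [normalizedValuation, map_zero, map_zero] at hϖ
    exact WithZero.exp_ne_zero hϖ.symm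
  have hϖ1 : ValuativeRel.valuation K ϖ < 1 := by
    rw [← normalizedValuation_lt_one_iff, hϖ, ← WithZero.exp_zero, WithZero.exp_lt_exp]
    norm_num
  have hx' : ∀ i j, divisionValuation K D (e x i j) ≤ divisionValuation K D π := fun i j =>
    hmax _ ((orderReduction_apply_eq_zero_iff e).1 (by rw [hx]; rfl))
  have hpow : ∀ k i j, divisionValuation K D (e (x ^ k : matrixOrder e) i j) ≤
      divisionValuation K D π ^ k := by
    intro k
    induction k with
    | zero =>
      intro i j
      rw [pow_zero, pow_zero]
      exact (1 : matrixOrder e).2 i j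
    | succ k ih =>
      intro i j
      have : e ((x ^ (k + 1) : matrixOrder e) : B) =
          e ((x ^ k : matrixOrder e) : B) * e (x : B) := by
        rw [pow_succ, MulMemClass.coe_mul, map_mul]
      rw [this, Matrix.mul_apply]
      refine Valuation.map_sum_le _ fun l _ => ?_
      rw [map_mul, pow_succ]
      exact mul_le_mul' (ih i l) (hx' l j)
  refine ⟨n, ⟨ϖ, hϖ1.le⟩, (mem_maximalIdeal_iff K).2 hϖ1,
    ⟨ϖ⁻¹ • ((x ^ n : matrixOrder e) : B), fun i j => ?_⟩, Subtype.ext ?_⟩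
  · rw [map_smul, Matrix.smul_apply]
    obtain ⟨y, hy, h⟩ := exists_eq_smul_of_valuation_le hϖ0 ((hpow n i j).trans hn.ge)
    rw [h, inv_smul_smul₀ hϖ0]
    exact hy
  · exact (smul_inv_smul₀ hϖ0 _).symm

theorem exists_mul_one_add_eq_one {x : matrixOrder e} (hx : orderReduction e x = 0) :
    ∃ z, z * (1 + x) = 1 := by
  obtain ⟨k, r, hr, y, hy⟩ := exists_pow_eq_smul e hx
  let N : Submodule 𝒪[K] (matrixOrder e) := LinearMap.range (LinearMap.mulRight 𝒪[K] (1 + x))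
  have hle : (⊤ : Submodule 𝒪[K] (matrixOrder e)) ≤ N := by
    refine Submodule.le_of_le_smul_of_le_jacobson_bot
      (Module.Finite.fg_top) (I := IsLocalRing.maximalIdeal 𝒪[K])
      (IsLocalRing.maximalIdeal_le_jacobson _) fun z _ => ?_
    have hstep : ∀ i ≤ k, z * x ^ (k - i) ∈
        N ⊔ IsLocalRing.maximalIdeal 𝒪[K] • (⊤ : Submodule 𝒪[K] (matrixOrder e)) := by
      intro i
      induction i with
      | zero =>
        intro _
        rw [Nat.sub_zero, hy, mul_smul_comm]
        exact Submodule.mem_sup_right (Submodule.smul_mem_smul hr trivial)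
      | succ i ih =>
        intro hi
        have h1 : z * x ^ (k - (i + 1)) =
            z * x ^ (k - (i + 1)) * (1 + x) - z * x ^ (k - i) := by
          rw [show k - i = k - (i + 1) + 1 by omega, pow_succ, mul_add, mul_one, mul_assoc,
            add_sub_cancel_right]
        rw [h1]
        exact sub_mem (Submodule.mem_sup_left ⟨_, rfl⟩) (ih (by omega))
    simpa using hstep k le_rfl
  exact hle trivial

theorem isReduction_orderReduction : IsReduction (orderReduction e) := by
  refine ⟨orderReduction_surjective e, le_antisymm (fun x hx => ?_) ?_⟩
  · rw [← Ideal.jacobson_bot, Ideal.mem_jacobson_iff]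
    intro y
    obtain ⟨z, hz⟩ := exists_mul_one_add_eq_one e (x := y * x) (by
      rw [map_mul, (RingHom.mem_ker).1 hx, mul_zero])
    refine ⟨z, ?_⟩
    rw [Ideal.mem_bot, ← hz]
    noncomm_ring
  · intro x hx
    have : RingHomSurjective (orderReduction e) := ⟨orderReduction_surjective e⟩
    have h := Ring.le_comap_jacobson (orderReduction e) hx
    rw [Ideal.mem_comap, show Ring.jacobson (Matrix (Fin m) (Fin m) (DivisionResidue K D)) = ⊥
      from IsSemisimpleModule.jacobson_eq_bot _ _] at h
    exact h

variable {e} in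
/-- Every maximal left ideal is principal, generated by a conjugate of `diag(π, 1, …, 1)`. -/
theorem exists_generator_of_isMaximal [Algebra.IsCentral K D] {P : Ideal (matrixOrder e)}
    (hP : P.IsMaximal) : ∃ y : matrixOrder e, P = Ideal.span {y} ∧
      ∃ ν : K, IsReducedNorm K (y : B) ν ∧ normalizedValuation K ν = WithZero.exp (-1 : ℤ) := by
  obtain ⟨π, hπ⟩ := exists_isDivisionUniformizer K D
  obtain ⟨ν, hν, hν1⟩ := hπ.exists_isReducedNorm
  obtain ⟨hπ0, hπ1, hmax⟩ := hπ
  have hρ := isReduction_orderReduction e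
  obtain ⟨v, hv, hPv⟩ := exists_eq_vecAnnihilator (hρ.isMaximal_map hP)
  obtain ⟨i₀, -⟩ := Function.ne_iff.1 hv
  have he₀ : (Pi.single i₀ 1 : Fin m → DivisionResidue K D) ≠ 0 := by simp
  have hmem : ∀ x, x ∈ P ↔ orderReduction e x *ᵥ v = 0 := fun x => by
    rw [← mem_vecAnnihilator, ← hPv, ← Ideal.mem_comap, hρ.comap_map hP]
  obtain ⟨Q, hQ⟩ := exists_GL_mulVec_eq hv he₀
  obtain ⟨q, hq⟩ := hρ.1 Q.val
  obtain ⟨U, rfl⟩ := hρ.isUnit_of_isUnit_map (x := q) (hq ▸ Q.isUnit)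
  let d := Matrix.diagonal (Function.update (1 : Fin m → D) i₀ π)
  let d' := Matrix.diagonal (Function.update (1 : Fin m → D) i₀ π⁻¹)
  have hd'd : d' * d = 1 := by
    rw [Matrix.diagonal_mul_diagonal, ← Matrix.diagonal_one]
    congr 1
    funext i
    rcases eq_or_ne i i₀ with rfl | hi
    · simp [hπ0]
    · simp [hi]
  have hdO : e.symm d ∈ matrixOrder e := fun i j => by
    rw [AlgEquiv.apply_symm_apply]
    change Matrix.diagonal (Function.update (1 : Fin m → D) i₀ π) i j ∈ divisionIntegers K D
    rw [Matrix.diagonal_apply]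
    split_ifs
    · rw [Function.update_apply]
      split_ifs
      · exact hπ1.le
      · exact one_mem _
    · exact zero_mem _
  let y₀ : matrixOrder e := ⟨e.symm d, hdO⟩
  have hcol : ∀ x : matrixOrder e, orderReduction e x *ᵥ Pi.single i₀ 1 = 0 ↔
      ∀ i, divisionValuation K D (e x i i₀) < 1 := fun x => by
    rw [Matrix.mulVec_single_one, funext_iff]
    exact forall_congr' fun i => orderReduction_apply_eq_zero_iff e
  have hy₀ : ∀ x : matrixOrder e, orderReduction e x *ᵥ Pi.single i₀ 1 = 0 ↔
      ∃ z, z * y₀ = x := by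
    intro x
    rw [hcol]
    constructor
    · intro h
      refine ⟨⟨e.symm (e x * d'), fun i j => ?_⟩, Subtype.ext ?_⟩
      · rw [AlgEquiv.apply_symm_apply, Matrix.mul_diagonal, Function.update_apply]
        split_ifs with hj
        · rw [hj, mem_divisionIntegers, map_mul, map_inv₀]
          exact mul_inv_le_one_of_le₀ (hmax _ (h i)) zero_le
        · rw [Pi.one_apply, mul_one]
          exact x.2 i j
      · change e.symm (e x * d') * e.symm d = x
        rw [← map_mul, mul_assoc, hd'd, mul_one, AlgEquiv.symm_apply_apply]
    · rintro ⟨z, rfl⟩ i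
      have : e ((z * y₀ : matrixOrder e) : B) = e z * d := by
        rw [MulMemClass.coe_mul, map_mul]
        congr 1
        exact e.apply_symm_apply d
      rw [this, Matrix.mul_diagonal, Function.update_self, map_mul]
      exact (mul_le_of_le_one_left' (z.2 i i₀)).trans_lt hπ1
  refine ⟨U.inv * y₀ * U, ?_, ν, ?_, hν1⟩
  · ext x
    rw [hmem, Ideal.mem_span_singleton']
    have hx : orderReduction e x *ᵥ v = orderReduction e (x * U.inv) *ᵥ Pi.single i₀ 1 := by
      rw [← hQ, ← hq, Matrix.mulVec_mulVec, ← map_mul, mul_assoc, U.inv_val, mul_one]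
    rw [hx, hy₀]
    constructor
    · rintro ⟨z, hz⟩
      refine ⟨z * U, ?_⟩
      have : z * U.val * (U.inv * y₀ * U.val) = z * y₀ * U.val := by
        rw [mul_assoc, ← mul_assoc U.val, ← mul_assoc U.val, U.val_inv, one_mul, ← mul_assoc]
      rw [this, hz, mul_assoc, U.inv_val, mul_one]
    · rintro ⟨z, rfl⟩
      refine ⟨z * U.inv, ?_⟩
      simp only [mul_assoc, U.val_inv, mul_one]
  · have h1 : IsReducedNorm K (e.symm d) ν := (hν.diagonal i₀).algEquiv e.symm
    exact h1.conj (Units.map (matrixOrder e).val.toMonoidHom U)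

end OrderReduction

/-! ### Left ideals of reduced norm `𝔭` are the maximal left ideals -/

section

variable {K : Type*} [Field K] {B : Type*} [Ring B] [Algebra K B]

theorem IsReducedNorm.one {b : B} {x : K} (h : IsReducedNorm K b x) :
    IsReducedNorm K (1 : B) 1 := by
  obtain ⟨n, φ, -⟩ := h
  refine ⟨n, φ, ?_⟩
  rw [← Algebra.TensorProduct.one_def, map_one, map_one, Matrix.det_one]

theorem sqrt_finrank_ne_zero [FiniteDimensional K B] [Nontrivial B] : (Module.finrank K B).sqrt ≠ 0 :=
  (Nat.sqrt_pos.2 Module.finrank_pos).ne'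

end

section

variable {K : Type*} [Field K] [ValuativeRel K] {B : Type*} [Ring B] [Algebra K B]

open ValuativeRel

theorem IsReducedNorm.valuation_eq [FiniteDimensional K B] [Nontrivial B] {b : B} {x y : K} (hx : IsReducedNorm K b x)
    (hy : IsReducedNorm K b y) : valuation K x = valuation K y := by
  have h := congrArg (valuation K) (hx.pow_eq.trans hy.pow_eq.symm)
  rw [map_pow, map_pow] at h
  exact (pow_left_inj₀ zero_le zero_le (sqrt_finrank_ne_zero (B := B))).1 h

theorem isReducedNorm_mem_idealReducedNorm [FiniteDimensional K B] [Nontrivial B]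
    {O : Subalgebra 𝒪[K] B} {P : Ideal O} {a : O}
    (ha : a ∈ P) {x : K} (hx : IsReducedNorm K (a : B) x) {z : K}
    (hz : valuation K z ≤ valuation K x) : z ∈ idealReducedNorm K P := by
  have hv := hx.reducedNorm.valuation_eq hx
  have hmem : reducedNorm K (a : B) ∈ idealReducedNorm K P :=
    Submodule.subset_span ⟨a, ha, rfl⟩
  rcases eq_or_ne (reducedNorm K (a : B)) 0 with h0 | h0
  · rw [h0, map_zero] at hv
    rw [← hv, le_zero_iff, Valuation.zero_iff] at hz
    rw [hz]
    exact zero_mem _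
  · have hr : valuation K (z / reducedNorm K (a : B)) ≤ 1 := by
      rw [map_div₀, hv]
      exact div_le_one_of_le₀ hz zero_le
    have := Submodule.smul_mem _ (⟨_, hr⟩ : 𝒪[K]) hmem
    have h2 : (⟨_, hr⟩ : 𝒪[K]) • reducedNorm K (a : B) = z := div_mul_cancel₀ z h0
    rwa [h2] at this

theorem valuation_lt_of_mem_idealReducedNorm {O : Subalgebra 𝒪[K] B} {P : Ideal O}
    {γ : ValueGroupWithZero K} (hγ : 0 < γ)
    (h : ∀ a ∈ P, ∀ x, IsReducedNorm K (a : B) x → valuation K x < γ) {x : K}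
    (hx : x ∈ idealReducedNorm K P) : valuation K x < γ := by
  rw [idealReducedNorm] at hx
  induction hx using Submodule.span_induction with
  | mem x hx =>
    obtain ⟨a, ha, rfl⟩ := hx
    rcases reducedNorm_eq_zero_or (K := K) (a : B) with h0 | h0
    · rw [h0, map_zero]
      exact hγ
    · exact h a ha _ h0
  | zero => rw [map_zero]; exact hγ
  | add x y _ _ hx hy => exact (valuation K).map_add_lt hx hy
  | smul r x _ hx =>
    have : r • x = (r : K) * x := rfl
    rw [this, map_mul]
    exact (mul_le_of_le_one_left' r.2).trans_lt hx

end

section IdealNorm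

variable {K : Type*} [Field K] [ValuativeRel K] [TopologicalSpace K]
  [IsNonarchimedeanLocalField K] {B : Type*} [Ring B] [Algebra K B]

open ValuativeRel

theorem rightNorm_of_isLattice {O : Subalgebra 𝒪[K] B} (hO : IsOrder K O) (a : O) :
    ∃ r : 𝒪[K], rightNorm K (a : B) = r ∧ (IsUnit r → ∃ z, z * a = 1) := by
  classical
  have : (Subalgebra.toSubmodule O).IsLattice K := hO
  have hfree : Module.Free 𝒪[K] O :=
    Submodule.IsLattice.free (K := K) (Subalgebra.toSubmodule O)
  have hfin : Module.Finite 𝒪[K] O := Submodule.IsLattice.finite K (Subalgebra.toSubmodule O)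
  let b : Module.Basis (Module.Free.ChooseBasisIndex 𝒪[K] O) 𝒪[K] (Subalgebra.toSubmodule O) :=
    Module.Free.chooseBasis 𝒪[K] O
  let bK := b.extendOfIsLattice K
  have hrepr : ∀ (x : O) i, bK.repr (x : B) i = (b.repr x i : K) := by
    intro x i
    have hx : (x : B) = ∑ k, (b.repr x k : K) • bK k := by
      have h := congrArg (fun y : Subalgebra.toSubmodule O => (y : B)) (b.sum_repr x)
      rw [AddSubmonoidClass.coe_finsetSum] at h
      refine h.symm.trans (Finset.sum_congr rfl fun k _ => ?_)
      rw [Module.Basis.extendOfIsLattice_apply]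
      rfl
    rw [hx, ← Module.Basis.equivFun_symm_apply, ← Module.Basis.equivFun_apply,
      LinearEquiv.apply_symm_apply]
  let b' : Module.Basis _ 𝒪[K] O := b
  refine ⟨LinearMap.det (LinearMap.mulRight 𝒪[K] a), ?_, fun hu => ?_⟩
  · rw [rightNorm, ← LinearMap.det_toMatrix bK, ← LinearMap.det_toMatrix b']
    change _ = algebraMap 𝒪[K] K _
    rw [RingHom.map_det]
    congr 1
    ext i j
    rw [LinearMap.toMatrix_apply, Module.Basis.extendOfIsLattice_apply, RingHom.mapMatrix_apply,
      Matrix.map_apply, LinearMap.toMatrix_apply]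
    exact hrepr (b' j * a) i
  · have h := (LinearMap.isUnit_iff_isUnit_det _).2 hu
    obtain ⟨z, hz⟩ := ((Module.End.isUnit_iff _).1 h).2 1
    exact ⟨z, hz⟩

theorem mem_map_maximalIdeal_iff {x : K} :
    x ∈ Submodule.map (Algebra.linearMap 𝒪[K] K) (IsLocalRing.maximalIdeal 𝒪[K]) ↔
      valuation K x < 1 := by
  rw [Submodule.mem_map]
  constructor
  · rintro ⟨r, hr, rfl⟩
    exact (mem_maximalIdeal_iff K).1 hr
  · intro h
    exact ⟨⟨x, h.le⟩, (mem_maximalIdeal_iff K).2 h, rfl⟩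

theorem valuation_lt_one_of_not_isUnit {r : 𝒪[K]} (hr : ¬ IsUnit r) : valuation K (r : K) < 1 :=
  (mem_maximalIdeal_iff K).1 ((IsLocalRing.mem_maximalIdeal r).2 hr)

variable [FiniteDimensional K B]

/-- The reduced norm of a non-unit multiple of `y` is divisible by `𝔭 nrd(y)`. -/
theorem valuation_reducedNorm_mul_lt {O : Subalgebra 𝒪[K] B} (hO : IsOrder K O) {y b : O}
    (hb : ¬ ∃ z, z * b = 1) {ν x : K} (hν0 : ν ≠ 0) (hν : IsReducedNorm K (y : B) ν)
    (hx : IsReducedNorm K ((b * y : O) : B) x) : valuation K x < valuation K ν := by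
  obtain ⟨r, hr, hu⟩ := rightNorm_of_isLattice hO b
  have h1 := valuation_lt_one_of_not_isUnit fun h => hb (hu h)
  have h := hx.pow_eq
  rw [MulMemClass.coe_mul, rightNorm_mul, ← hν.pow_eq, hr] at h
  have h2 := congrArg (valuation K) h
  rw [map_mul, map_pow, map_pow] at h2
  refine lt_of_pow_lt_pow_left₀ (Module.finrank K B).sqrt zero_le ?_
  rw [h2]
  exact mul_lt_of_lt_one_left (pow_pos (zero_lt_iff.2 ((valuation K).ne_zero_iff.2 hν0)) _) h1

variable [Nontrivial B]

theorem idealReducedNorm_eq_iff {O : Subalgebra 𝒪[K] B} (hO : IsOrder K O)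
    (hgen : ∀ P : Ideal O, P.IsMaximal → ∃ y : O, P = Ideal.span {y} ∧ ∃ ν : K,
      IsReducedNorm K (y : B) ν ∧ normalizedValuation K ν = WithZero.exp (-1 : ℤ))
    (P : Ideal O) :
    idealReducedNorm K P =
        Submodule.map (Algebra.linearMap 𝒪[K] K) (IsLocalRing.maximalIdeal 𝒪[K]) ↔
      P.IsMaximal := by
  have hνlt : ∀ ν : K, normalizedValuation K ν = WithZero.exp (-1 : ℤ) →
      ν ≠ 0 ∧ valuation K ν < 1 := fun ν hν => by
    refine ⟨?_, ?_⟩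
    · rintro rfl
      rw [normalizedValuation, map_zero, map_zero] at hν
      exact WithZero.exp_ne_zero hν.symm
    · rw [← normalizedValuation_lt_one_iff, hν, ← WithZero.exp_zero, WithZero.exp_lt_exp]
      norm_num
  constructor
  · intro h
    have htop : P ≠ ⊤ := by
      rintro rfl
      obtain ⟨P₁, hP₁⟩ := Ideal.exists_maximal O
      obtain ⟨y, -, ν, hν, -⟩ := hgen P₁ hP₁
      have h1 := isReducedNorm_mem_idealReducedNorm (P := (⊤ : Ideal O)) (a := 1) trivial
        hν.one le_rfl
      rw [h, mem_map_maximalIdeal_iff, map_one] at h1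
      exact lt_irrefl _ h1
    obtain ⟨P₁, hP₁, hle⟩ := Ideal.exists_le_maximal P htop
    obtain ⟨y, rfl, ν, hν, hν1⟩ := hgen P₁ hP₁
    obtain ⟨hν0, hνlt1⟩ := hνlt ν hν1
    by_contra hP
    have hyP : y ∉ P := fun hy => hP <| by
      rwa [le_antisymm hle ((Ideal.span_singleton_le_iff_mem P).2 hy)]
    have hmem : ν ∈ idealReducedNorm K P := by
      rw [h, mem_map_maximalIdeal_iff]
      exact hνlt1
    refine lt_irrefl _ (valuation_lt_of_mem_idealReducedNorm
      (zero_lt_iff.2 ((valuation K).ne_zero_iff.2 hν0)) (fun a ha x hx => ?_) hmem)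
    obtain ⟨b, rfl⟩ := Ideal.mem_span_singleton'.1 (hle ha)
    refine valuation_reducedNorm_mul_lt hO ?_ hν0 hν hx
    rintro ⟨z, hz⟩
    refine hyP ?_
    rw [← one_mul y, ← hz, mul_assoc]
    exact P.mul_mem_left z ha
  · intro hP
    obtain ⟨y, hPy, ν, hν, hν1⟩ := hgen P hP
    refine le_antisymm (fun x hx => ?_) (fun x hx => ?_)
    · rw [mem_map_maximalIdeal_iff]
      refine valuation_lt_of_mem_idealReducedNorm zero_lt_one (fun a ha x hx => ?_) hx
      rw [← map_one (valuation K)]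
      refine valuation_reducedNorm_mul_lt hO (y := 1) (b := a) ?_ one_ne_zero hx.one
        (by rwa [mul_one])
      rintro ⟨z, hz⟩
      exact hP.ne_top ((Ideal.eq_top_iff_one _).2 (hz ▸ P.mul_mem_left z ha))
    · rw [mem_map_maximalIdeal_iff, ← normalizedValuation_lt_one_iff] at hx
      refine isReducedNorm_mem_idealReducedNorm
        (hPy ▸ Ideal.mem_span_singleton_self y) hν ?_
      rw [← map_le_map_iff (IsNonarchimedeanLocalField.valueGroupWithZeroIsoInt K)]
      change normalizedValuation K x ≤ normalizedValuation K ν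
      rw [hν1]
      rcases eq_or_ne (normalizedValuation K x) 0 with h0 | h0
      · rw [h0]
        exact zero_le
      · rw [← WithZero.exp_zero, ← WithZero.log_lt_iff_lt_exp h0] at hx
        rw [← WithZero.log_le_iff_le_exp h0]
        omega

end IdealNorm

/-! ### Right multiplication by units -/

section RightMul

variable {S : Type*} [Ring S]

/-- Right multiplication by a unit as an automorphism of the left regular module. -/
def mulRightEquiv (ω : Sˣ) : S ≃ₗ[S] S :=
  LinearEquiv.ofLinearMap (LinearMap.toSpanSingleton S S ω) (LinearMap.toSpanSingleton S S ω.inv)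
    (by ext; simp) (by ext; simp)

theorem isMaximal_map_toSpanSingleton {P : Ideal S} (hP : P.IsMaximal) (ω : Sˣ) :
    Ideal.IsMaximal (Submodule.map (LinearMap.toSpanSingleton S S (ω : S)) P) := by
  have h := ((Submodule.orderIsoMapComap (mulRightEquiv ω)).isCoatom_iff P).2 hP.out
  exact ⟨h⟩

theorem map_toSpanSingleton_map (P : Ideal S) {ω ω' : S} (h : ω * ω' = 1) :
    Submodule.map (LinearMap.toSpanSingleton S S ω')
      (Submodule.map (LinearMap.toSpanSingleton S S ω) P) = P := by
  rw [← Submodule.map_comp]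
  convert Submodule.map_id P
  ext
  simp [h]

theorem map_map_toSpanSingleton {T : Type*} [Ring T] {ρ : S →+* T}
    (hρ : Function.Surjective ρ) {P : Ideal S} {A : T} (hA : Ideal.span {A} = Ideal.map ρ P)
    (ω : S) :
    Ideal.span {A * ρ ω} =
      Ideal.map ρ (Submodule.map (LinearMap.toSpanSingleton S S ω) P : Ideal S) := by
  ext X
  rw [Ideal.mem_span_singleton', Ideal.mem_map_iff_of_surjective ρ hρ]
  constructor
  · rintro ⟨Y, rfl⟩
    have hY : Y * A ∈ Ideal.map ρ P := hA ▸ Ideal.mem_span_singleton'.2 ⟨Y, rfl⟩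
    obtain ⟨a, ha, haY⟩ := (Ideal.mem_map_iff_of_surjective ρ hρ).1 hY
    refine ⟨a * ω, ⟨a, ha, rfl⟩, ?_⟩
    rw [map_mul, haY, mul_assoc]
  · rintro ⟨_, ⟨a, ha, rfl⟩, rfl⟩
    have hY : ρ a ∈ Ideal.span {A} := hA ▸ Ideal.mem_map_of_mem ρ ha
    obtain ⟨Y, hY⟩ := Ideal.mem_span_singleton'.1 hY
    refine ⟨Y, ?_⟩
    rw [LinearMap.toSpanSingleton_apply, smul_eq_mul, map_mul, ← hY, mul_assoc]

end RightMul

section Classes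

variable {F : Type*} [Field F] {m : ℕ}

theorem CorankOneClasses.mk_eq_mk_iff {A A' : Matrix (Fin m) (Fin m) F} (hA : A.rank + 1 = m)
    (hA' : A'.rank + 1 = m) :
    CorankOneClasses.mk A hA = CorankOneClasses.mk A' hA' ↔
      Ideal.span {A} = Ideal.span {A'} := by
  rw [span_singleton_eq_iff]
  exact Quotient.eq (r := leftUnitSetoid m F)

theorem CorankOneClasses.exists_mk_eq (c : CorankOneClasses m F) :
    ∃ A hA, c = CorankOneClasses.mk A hA := by
  induction c using Quotient.inductionOn with
  | h A => exact ⟨A.1, A.2, rfl⟩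

end Classes

section Center

theorem isCentral_of_algEquiv_matrix {K : Type*} [Field K] {B : Type v} [Ring B] [Algebra K B]
    [Algebra.IsCentral K B] {D : Type v} [DivisionRing D] [Algebra K D] {m : ℕ} [NeZero m]
    (e : B ≃ₐ[K] Matrix (Fin m) (Fin m) D) : Algebra.IsCentral K D := by
  have : Algebra.IsCentral K (Matrix (Fin m) (Fin m) D) := .of_algEquiv K _ _ e
  refine ⟨fun c hc => ?_⟩
  have h : Matrix.scalarAlgHom (Fin m) K c ∈
      Subalgebra.center K (Matrix (Fin m) (Fin m) D) := by
    rw [Matrix.subalgebraCenter_eq_scalarAlgHom_map]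
    exact ⟨c, hc, rfl⟩
  obtain ⟨a, ha⟩ := (Algebra.IsCentral.mem_center_iff K).1 h
  have h0 := congrFun (congrFun ha 0) 0
  rw [Matrix.algebraMap_matrix_apply, if_pos rfl] at h0
  have h1 : (Matrix.scalarAlgHom (Fin m) K c) 0 0 = c := by
    simp [Matrix.scalarAlgHom]
  exact ⟨a, by rw [← h1, h0]; rfl⟩

end Center

/-! ### Metacommutation -/

section Metacomm

variable {R : Type*} [CommRing R] {B : Type*} [Ring B] [Algebra R B] {O : Subalgebra R B}

theorem metacomm_eq_map {p : Ideal R} (hp : Ideal.map (algebraMap R O) p ≤ Ring.jacobson O)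
    {P : Ideal O} (hP : P.IsMaximal) (ω : Oˣ) :
    metacomm p (ω : O) P = Submodule.map (LinearMap.toSpanSingleton O O (ω : O)) P :=
  sup_eq_left.2 (hp.trans
    (@Ring.jacobson_le_of_isMaximal _ _ _ (isMaximal_map_toSpanSingleton hP ω)))

/-- The permutation `P ↦ P ω + O 𝔭` of a set of maximal left ideals that contains all of them. -/
def metacommPerm {p : Ideal R} (hp : Ideal.map (algebraMap R O) p ≤ Ring.jacobson O)
    {q : Ideal O → Prop} (hq : ∀ P, q P ↔ P.IsMaximal) (ω : Oˣ) : Equiv.Perm {P // q P} where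
  toFun P := ⟨metacomm p (ω : O) P.1, by
    have hP := (hq P.1).1 P.2
    rw [hq, metacomm_eq_map hp hP]
    exact isMaximal_map_toSpanSingleton hP ω⟩
  invFun P := ⟨metacomm p ((ω⁻¹ : Oˣ) : O) P.1, by
    have hP := (hq P.1).1 P.2
    rw [hq, metacomm_eq_map hp hP]
    exact isMaximal_map_toSpanSingleton hP ω⁻¹⟩
  left_inv P := by
    have hP := (hq P.1).1 P.2
    refine Subtype.ext ?_
    change metacomm p ((ω⁻¹ : Oˣ) : O) (metacomm p (ω : O) P.1) = P.1
    rw [metacomm_eq_map hp hP, metacomm_eq_map hp (isMaximal_map_toSpanSingleton hP ω),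
      map_toSpanSingleton_map _ ω.mul_inv]
  right_inv P := by
    have hP := (hq P.1).1 P.2
    refine Subtype.ext ?_
    change metacomm p (ω : O) (metacomm p ((ω⁻¹ : Oˣ) : O) P.1) = P.1
    rw [metacomm_eq_map hp hP, metacomm_eq_map hp (isMaximal_map_toSpanSingleton hP ω⁻¹),
      map_toSpanSingleton_map _ ω.inv_mul]

end Metacomm

section Generators

variable {S : Type v} [Ring S] {m : ℕ} {F : Type w} [Field F]
  {ρ : S →+* Matrix (Fin m) (Fin m) F}

/-- The class of the generators of `ρ(P)` is a bijection from the maximal left ideals `P` of `S`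
to the matrices of corank one up to left units. -/
theorem IsReduction.exists_generator_equiv (hρ : IsReduction ρ) {q : Ideal S → Prop}
    (hq : ∀ P, q P ↔ P.IsMaximal) :
    ∃ Φ : {P // q P} ≃ CorankOneClasses m F, ∀ P (A : Matrix (Fin m) (Fin m) F),
      Ideal.span {A} = Ideal.map ρ P.1 ↔
        ∃ hA : A.rank + 1 = m, Φ P = CorankOneClasses.mk A hA := by
  have key : ∀ P : {P // q P}, ∃ A : Matrix (Fin m) (Fin m) F,
      Ideal.span {A} = Ideal.map ρ P.1 ∧ A.rank + 1 = m := fun P => by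
    have hmax := hρ.isMaximal_map ((hq P.1).1 P.2)
    obtain ⟨A, -, hA⟩ := IsSemisimpleRing.ideal_eq_span_idempotent (Ideal.map ρ P.1)
    exact ⟨A, hA.symm, (span_singleton_isMaximal_iff A).1 (hA ▸ hmax)⟩
  choose A hA hA1 using key
  refine ⟨Equiv.ofBijective (fun P => CorankOneClasses.mk (A P) (hA1 P)) ⟨fun P P' h => ?_,
    fun c => ?_⟩, fun P A' => ?_⟩
  · have h := (CorankOneClasses.mk_eq_mk_iff _ _).1 h
    rw [hA, hA] at h
    refine Subtype.ext ?_
    rw [← hρ.comap_map ((hq P.1).1 P.2), h, hρ.comap_map ((hq P'.1).1 P'.2)]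
  · obtain ⟨A', hA', rfl⟩ := c.exists_mk_eq
    have hmax : (Ideal.span {A'}).IsMaximal := (span_singleton_isMaximal_iff A').2 hA'
    refine ⟨⟨Ideal.comap ρ (Ideal.span {A'}),
      (hq _).2 (Ideal.comap_isMaximal_of_surjective ρ hρ.1)⟩, ?_⟩
    rw [CorankOneClasses.mk_eq_mk_iff, hA, Ideal.map_comap_of_surjective ρ hρ.1]
  · rw [← hA P]
    constructor
    · intro h
      have hA' : A'.rank + 1 = m := by
        rw [← span_singleton_isMaximal_iff, h, span_singleton_isMaximal_iff]
        exact hA1 P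
      exact ⟨hA', (CorankOneClasses.mk_eq_mk_iff _ _).2 h.symm⟩
    · rintro ⟨hA', h⟩
      exact ((CorankOneClasses.mk_eq_mk_iff _ _).1 h).symm

end Generators

end Metacommutation

theorem mainTheorem2
    {K : Type u} [Field K] [ValuativeRel K] [TopologicalSpace K] [IsNonarchimedeanLocalField K]
    {B : Type v} [Ring B] [Algebra K B] [FiniteDimensional K B] [Algebra.IsCentral K B]
    [IsSimpleRing B]
    (O : Subalgebra 𝒪[K] B) (hO : Metacommutation.IsMaximalOrder K O) :
    -- the reduction map `ρ : O → O / rad O ≃ M_m(F)` exists, where `B ≃ M_m(D)`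
    (∃ m : ℕ, 0 < m ∧
      (∃ (D : Type v) (_ : DivisionRing D) (_ : Algebra K D),
        Nonempty (B ≃ₐ[K] Matrix (Fin m) (Fin m) D)) ∧
      ∃ (F : Type v) (_ : Field F) (_ : Algebra 𝓀[K] F) (ρ : O →+* Matrix (Fin m) (Fin m) F),
        FiniteDimensional 𝓀[K] F ∧ Metacommutation.IsReduction ρ ∧
        ∀ r : 𝒪[K], ρ (algebraMap 𝒪[K] O r) =
          algebraMap 𝓀[K] (Matrix (Fin m) (Fin m) F) (IsLocalRing.residue 𝒪[K] r)) ∧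
    -- `P ↦ P ω + O 𝔭` is a permutation `σ_ω` of `Id(O; 𝔭)` for every unit `ω` of `O`
    ∃ σ : (↥O)ˣ → Equiv.Perm (Metacommutation.IdealsOfNorm K O (IsLocalRing.maximalIdeal 𝒪[K])),
      (∀ ω P, (σ ω P).1 =
        Metacommutation.metacomm (IsLocalRing.maximalIdeal 𝒪[K]) (ω : O) P.1) ∧
      -- for every reduction map `ρ`, `P ↦ {generators of ρ(P)}` carries `σ_ω` to `σ_{ρ(ω)}`
      ∀ (m : ℕ) (F : Type w) [Field F] (ρ : O →+* Matrix (Fin m) (Fin m) F),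
        Metacommutation.IsReduction ρ →
        ∃ Φ : Metacommutation.IdealsOfNorm K O (IsLocalRing.maximalIdeal 𝒪[K]) ≃
            Metacommutation.CorankOneClasses m F,
          (∀ P (A : Matrix (Fin m) (Fin m) F),
            Ideal.span {A} = Ideal.map ρ P.1 ↔
              ∃ hA : A.rank + 1 = m, Φ P = Metacommutation.CorankOneClasses.mk A hA) ∧
          ∀ ω : (↥O)ˣ, Φ.permCongr (σ ω) =
            Metacommutation.sigmaQ (Units.map (ρ : ↥O →* Matrix (Fin m) (Fin m) F) ω) := by
  have := IsArtinianRing.of_finite K B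
  obtain ⟨m, _, D, _, _, _, ⟨e₀⟩⟩ :=
    IsSimpleRing.exists_algEquiv_matrix_divisionRing_finite K B
  have := Metacommutation.isCentral_of_algEquiv_matrix e₀
  obtain ⟨e, rfl⟩ := hO.exists_eq_matrixOrder e₀
  have hred := Metacommutation.isReduction_orderReduction e
  have hmax := Metacommutation.idealReducedNorm_eq_iff hO.prop
    fun P hP => Metacommutation.exists_generator_of_isMaximal hP
  have hp : Ideal.map (algebraMap 𝒪[K] (Metacommutation.matrixOrder e))
      (IsLocalRing.maximalIdeal 𝒪[K]) ≤ Ring.jacobson (Metacommutation.matrixOrder e) := by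
    rw [← hred.2, Ideal.map_le_iff_le_comap]
    intro r hr
    rw [Ideal.mem_comap, RingHom.mem_ker, Metacommutation.orderReduction_algebraMap,
      (IsLocalRing.residue_eq_zero_iff r).2 hr, map_zero]
  refine ⟨⟨m, Nat.pos_of_neZero m, ⟨D, _, _, ⟨e₀⟩⟩, Metacommutation.DivisionResidue K D,
    inferInstance, inferInstance, Metacommutation.orderReduction e, inferInstance, hred,
    Metacommutation.orderReduction_algebraMap e⟩,
    Metacommutation.metacommPerm hp hmax, fun ω P => rfl, fun m' F _ ρ hρ => ?_⟩
  obtain ⟨Φ, hΦ⟩ := hρ.exists_generator_equiv hmax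
  refine ⟨Φ, hΦ, fun ω => Equiv.ext fun c => ?_⟩
  obtain ⟨P, rfl⟩ := Φ.surjective c
  obtain ⟨A, hA, hPA⟩ := (Φ P).exists_mk_eq
  change Φ (Metacommutation.metacommPerm hp hmax ω (Φ.symm (Φ P))) = _
  rw [Equiv.symm_apply_apply]
  have hspan := (hΦ P A).2 ⟨hA, hPA⟩
  have h := Metacommutation.map_map_toSpanSingleton hρ.1 hspan (ω : Metacommutation.matrixOrder e)
  rw [← Metacommutation.metacomm_eq_map hp ((hmax P.1).1 P.2) ω] at h
  obtain ⟨hA', hσ⟩ := (hΦ (Metacommutation.metacommPerm hp hmax ω P) (A * ρ ω)).1 h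
  rw [hPA]
  exact hσ

end
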